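/- Let $q$ be a prime power, $A=\mathbb F_q[\theta]$, $K_\infty=\mathbb F_q((\theta^{-1}))$, and let $\mathbb C_\infty$ be the completion of an algebraic closure of $K_\infty$. Let $\mathbb C_\infty\{\tau\}$ be the ring of twisted polynomials, with $\tau c=c^q\tau$ for $c\in\mathbb C_\infty$; its elements $\sum_n c_n\tau^n$ act on $\mathbb C_\infty$ by $x\mapsto\sum_n c_n x^{q^n}$. Let $r\ge 2$ and let $\mathfrak d$ be a Drinfeld $A$-module of rank $r$ over $\mathbb C_\infty$, i.e. an $\mathbb F_q$-algebra homomorphism $A\to\mathbb C_\infty\{\tau\}$, $a\mapsto\mathfrak d_a$, such that $\mathfrak d_a$ has constant term $a$ for every $a\in A$ and $\mathfrak d_\theta=\theta+g_1\tau+\cdots+g_r\tau^r$ with $g_r\neq 0$. Let $e_{\mathfrak d}(z)=\sum_{n\ge0}\alpha_n z^{q^n}$, $\alpha_0=1$, be its exponential function, the unique $\mathbb F_q$-linear entire function of this form with $e_{\mathfrak d}(az)=\mathfrak d_a(e_{\mathfrak d}(z))$ for all $a\in A$, and let $\Lambda=\ker e_{\mathfrak d}\subset\mathbb C_\infty$,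 an $A$-submodule. A biderivation of $\mathfrak d$ is an $\mathbb F_q$-linear map $\delta:A\to\mathbb C_\infty\{\tau\}\tau$, $a\mapsto\delta_a$, such that $\delta_{ab}=a\,\delta_b+\delta_a\mathfrak d_b$ for all $a,b\in A$; it is strictly inner if $\delta_a=am-m\mathfrak d_a$ for some $m\in\mathbb C_\infty\{\tau\}\tau$ and all $a\in A$. The de Rham cohomology $H^1_{\mathrm{DR}}(\mathfrak d)$ is the $\mathbb C_\infty$-vector space of biderivations modulo strictly inner ones. For each biderivation $\delta$ there is a unique $\mathbb F_q$-linear entire function $F_\delta(z)=\sum_{n\ge1}c_nz^{q^n}$ with $F_\delta(az)=aF_\delta(z)+\delta_a(e_{\mathfrak d}(z))$ for all $a\in A$. The restriction $F_\delta|_\Lambda$ is $A$-linear and vanishes if $\delta$ is strictly inner, so $[\delta]\mapsto F_\delta|_\Lambda$ defines a $\mathbb C_\infty$-linear map $$\mathrm{DR}:H^1_{\mathrm{DR}}(\mathfrak d)\longrightarrow\operatorname{Hom}_A(\Lambda,\mathbb C_\infty),$$ the de Rham morphism (cycle class map). Then $\mathrm{DR}$ is an isomorphism. -/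

import Mathlib

noncomputable section

namespace DrinfeldDeRham
open scoped Polynomial
open Filter Topology
open scoped NNReal WithZero

variable (F : Type*) [Field F] [Fintype F]

/-! ### The field `C_∞`

Throughout `F` is the finite field with `q = Fintype.card F` elements, the polynomial ring `F[X]` is
`A = F_q[θ]` (so `Polynomial.X` is `θ`) and `RatFunc F` is `K = F_q(θ)`. -/

section KInfty

attribute [local instance] Classical.propDecidable

/-- `K_∞ = F((θ⁻¹))`, the completion of `K = F(θ)` at the place at infinity. -/
def KInfty : Type _ := RatFunc.CompletionAtInfty F

instance : Field (KInfty F) := inferInstanceAs (Field (RatFunc.CompletionAtInfty F))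

instance : Algebra (RatFunc F) (KInfty F) :=
  inferInstanceAs (Algebra (RatFunc F) (RatFunc.CompletionAtInfty F))

/-- The valuation of `K_∞` extends the valuation `a ↦ exp (deg a)` of `K`. -/
instance : Valued (KInfty F) ℤᵐ⁰ :=
  inferInstanceAs (Valued (RatFunc.CompletionAtInfty F) ℤᵐ⁰)

instance : CompleteSpace (KInfty F) := by
  let _ : UniformSpace (RatFunc F) := (RatFunc.inftyValued F).toUniformSpace
  exact inferInstanceAs (CompleteSpace (UniformSpace.Completion (RatFunc F)))

lemma valued_algebraMap (x : RatFunc F) :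
    Valued.v (algebraMap (RatFunc F) (KInfty F) x) = RatFunc.inftyValuation F x := by
  let _ := RatFunc.inftyValued F
  exact Valued.extensionValuation_apply_coe x

lemma valued_theta :
    Valued.v (algebraMap (RatFunc F) (KInfty F) RatFunc.X) = WithZero.exp (1 : ℤ) := by
  rw [valued_algebraMap, RatFunc.inftyValuation.X]

lemma one_lt_card : (1 : ℝ≥0) < (Fintype.card F : ℝ≥0) := by
  exact_mod_cast Fintype.one_lt_card

/-- Normalization of the absolute value: `|x| = q ^ deg x`. -/
instance : (Valued.v : Valuation (KInfty F) ℤᵐ⁰).RankOne where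
  hom' := (WithZeroMulInt.toNNReal (one_lt_card F).ne_zero).comp
    MonoidWithZeroHom.ValueGroup₀.embedding
  strictMono' := (WithZeroMulInt.toNNReal_strictMono (one_lt_card F)).comp
    MonoidWithZeroHom.ValueGroup₀.embedding_strictMono
  exists_val_nontrivial := ⟨algebraMap (RatFunc F) (KInfty F) RatFunc.X, by
    rw [valued_theta]; simp⟩

instance : NontriviallyNormedField (KInfty F) :=
  Valued.toNontriviallyNormedField (KInfty F) ℤᵐ⁰

instance : IsUltrametricDist (KInfty F) := 
  Valued.instIsUltrametricDist (KInfty F) ℤᵐ⁰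

lemma norm_KInfty (x : KInfty F) :
    ‖x‖ = WithZeroMulInt.toNNReal (one_lt_card F).ne_zero (Valued.v x) := by
  rw [← Valuation.embedding_restrict]
  rfl

lemma norm_theta_KInfty :
    ‖algebraMap (RatFunc F) (KInfty F) RatFunc.X‖ = Fintype.card F := by
  rw [norm_KInfty, valued_theta, WithZeroMulInt.toNNReal_neg_apply _ WithZero.exp_ne_zero]
  simp [WithZero.exp, WithZero.unzero_coe]


end KInfty

/-- An algebraic closure of `K_∞`, with the unique absolute value extending that of `K_∞` (the
spectral norm). -/
def KInftyAlgCl : Type _ := AlgebraicClosure (KInfty F)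

instance : Field (KInftyAlgCl F) := inferInstanceAs (Field (AlgebraicClosure (KInfty F)))

instance : Algebra (KInfty F) (KInftyAlgCl F) :=
  inferInstanceAs (Algebra (KInfty F) (AlgebraicClosure (KInfty F)))

instance : IsAlgClosure (KInfty F) (KInftyAlgCl F) :=
  inferInstanceAs (IsAlgClosure (KInfty F) (AlgebraicClosure (KInfty F)))

instance : Algebra.IsAlgebraic (KInfty F) (KInftyAlgCl F) :=
  inferInstanceAs (Algebra.IsAlgebraic (KInfty F) (AlgebraicClosure (KInfty F)))

instance : NontriviallyNormedField (KInftyAlgCl F) :=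
  spectralNorm.nontriviallyNormedField (KInfty F) (KInftyAlgCl F)

instance : NormedAlgebra (KInfty F) (KInftyAlgCl F) :=
  spectralNorm.normedAlgebra (KInfty F) (KInftyAlgCl F)

/-- `C_∞`, the completion of an algebraic closure of `K_∞`. -/
def CInfty : Type _ := UniformSpace.Completion (KInftyAlgCl F)

instance : NormedField (CInfty F) :=
  inferInstanceAs (NormedField (UniformSpace.Completion (KInftyAlgCl F)))

instance : CompleteSpace (CInfty F) :=
  inferInstanceAs (CompleteSpace (UniformSpace.Completion (KInftyAlgCl F)))

instance : NormedAlgebra (KInfty F) (CInfty F) :=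
  inferInstanceAs (NormedAlgebra (KInfty F) (UniformSpace.Completion (KInftyAlgCl F)))

instance : IsUltrametricDist (CInfty F) := IsUltrametricDist.of_normedAlgebra (KInfty F)

/-- The embedding of `A` in `C_∞` through `K` and `K_∞`. -/
instance : Algebra F[X] (CInfty F) :=
  ((algebraMap (KInfty F) (CInfty F)).comp
    ((algebraMap (RatFunc F) (KInfty F)).comp (algebraMap F[X] (RatFunc F)))).toAlgebra

instance : Algebra F (CInfty F) :=
  ((algebraMap F[X] (CInfty F)).comp Polynomial.C).toAlgebra

instance : IsScalarTower F F[X] (CInfty F) := .of_algebraMap_eq fun _ => rfl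

/-- The element `θ` of `C_∞`. -/
def θ : CInfty F := algebraMap F[X] (CInfty F) Polynomial.X

lemma norm_θ : ‖θ F‖ = Fintype.card F := by
  have h : θ F = algebraMap (KInfty F) (CInfty F)
      (algebraMap (RatFunc F) (KInfty F) RatFunc.X) := by
    rw [← RatFunc.algebraMap_X]; rfl
  rw [h, norm_algebraMap', norm_theta_KInfty]

instance : NontriviallyNormedField (CInfty F) where
  non_trivial := ⟨θ F, by rw [norm_θ]; exact_mod_cast Fintype.one_lt_card⟩

/-! ### Twisted polynomials -/

/-- The `q`-Frobenius action on `C_∞`: the natural number `n` acts as `τ ^ n`, that is, as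
`x ↦ x ^ (q ^ n)`. -/
instance : MulSemiringAction (Multiplicative ℕ) (CInfty F) where
  smul n x := x ^ Fintype.card F ^ n.toAdd
  one_smul x := by change x ^ Fintype.card F ^ 0 = x; simp
  mul_smul m n x := by
    change x ^ Fintype.card F ^ (m.toAdd + n.toAdd)
      = (x ^ Fintype.card F ^ n.toAdd) ^ Fintype.card F ^ m.toAdd
    rw [← pow_mul, ← pow_add, add_comm]
  smul_zero n := by
    change (0 : CInfty F) ^ Fintype.card F ^ n.toAdd = 0
    exact zero_pow (pow_pos Fintype.card_pos _).ne'
  smul_add n x y := by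
    change (x + y) ^ Fintype.card F ^ n.toAdd
      = x ^ Fintype.card F ^ n.toAdd + y ^ Fintype.card F ^ n.toAdd
    have := map_add (FiniteField.frobeniusAlgHom F (CInfty F) ^ n.toAdd) x y
    simpa [AlgHom.coe_pow, FiniteField.coe_frobeniusAlgHom, pow_iterate] using this
  smul_one n := one_pow _
  smul_mul n x y := mul_pow _ _ _

lemma twist_smul (n : ℕ) (x : CInfty F) :
    Multiplicative.ofAdd n • x = x ^ Fintype.card F ^ n := rfl

instance : SMulCommClass (Multiplicative ℕ) F (CInfty F) where
  smul_comm n c x := by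
    change (c • x) ^ Fintype.card F ^ n.toAdd = c • x ^ Fintype.card F ^ n.toAdd
    rw [_root_.smul_pow, FiniteField.pow_card_pow]

instance : SMulCommClass F (Multiplicative ℕ) (CInfty F) := SMulCommClass.symm _ _ _

/-- The ring `C_∞{τ}` of twisted polynomials `∑ c_n τ ^ n`, in which `τ c = c ^ q τ`. -/
abbrev TwistedPolynomial : Type _ := SkewPolynomial (CInfty F)


variable {F}

/-- The action of a twisted polynomial on a module with an operator `T` in the role of `τ`:
`(∑ c_n τ ^ n) m = ∑ c_n T ^ n m`. -/
def twAct {M : Type*} [AddCommGroup M] [Module (CInfty F) M] (T : M →+ M)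
    (f : TwistedPolynomial F) (m : M) : M :=
  SkewPolynomial.sum f fun n c => c • T^[n] m

section twAct

variable {M N : Type*} [AddCommGroup M] [Module (CInfty F) M] [AddCommGroup N]
  [Module (CInfty F) N]

lemma twAct_monomial (T : M →+ M) (n : ℕ) (c : CInfty F) (m : M) :
    twAct T (SkewPolynomial.monomial n c) m = c • T^[n] m :=
  SkewPolynomial.sum_monomial_index (zero_smul _ _)

lemma twAct_add_left (T : M →+ M) (f g : TwistedPolynomial F) (m : M) :
    twAct T (f + g) m = twAct T f m + twAct T g m :=
  SkewPolynomial.sum_add_index f g _ (fun _ => zero_smul _ _) fun _ _ _ => add_smul _ _ _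

lemma twAct_zero_left (T : M →+ M) (m : M) : twAct T (0 : TwistedPolynomial F) m = 0 := by
  rw [← map_zero (SkewPolynomial.monomial 0), twAct_monomial, zero_smul]

lemma twAct_add_right (T : M →+ M) (f : TwistedPolynomial F) (m m' : M) :
    twAct T f (m + m') = twAct T f m + twAct T f m' := by
  simp only [twAct, iterate_map_add, smul_add]
  exact SkewPolynomial.sum_add _ _ _

lemma twAct_zero_right (T : M →+ M) (f : TwistedPolynomial F) : twAct T f (0 : M) = 0 := by
  simpa using twAct_add_right T f 0 0

lemma twAct_map (T : M →+ M) (S : N →+ N) (L : M →ₗ[CInfty F] N)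
    (h : ∀ m, L (T m) = S (L m)) (f : TwistedPolynomial F) (m : M) :
    L (twAct T f m) = twAct S f (L m) := by
  have h' : ∀ n : ℕ, ∀ m, L (T^[n] m) = S^[n] (L m) := by
    intro n
    induction n with
    | zero => intro m; rfl
    | succ n ih => intro m; rw [Function.iterate_succ_apply, ih, h, Function.iterate_succ_apply]
  simp only [twAct, SkewPolynomial.sum_def, map_sum, map_smul, h']

lemma twAct_smul_left (T : M →+ M) (c : CInfty F) (f : TwistedPolynomial F) (m : M) :
    twAct T (c • f) m = c • twAct T f m := by
  induction f using SkewPolynomial.induction with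
  | h0 => simp [twAct_zero_left]
  | ha n r q _ _ ih =>
    rw [smul_add, twAct_add_left, ih, SkewPolynomial.smul_monomial, twAct_monomial,
      twAct_add_left, twAct_monomial, smul_add, smul_eq_mul, mul_smul]

lemma twAct_mul (T : M →+ M) (hT : ∀ (c : CInfty F) (m : M), T (c • m) = c ^ Fintype.card F • T m)
    (f g : TwistedPolynomial F) (m : M) : twAct T (f * g) m = twAct T f (twAct T g m) := by
  have hT' : ∀ (n : ℕ) (c : CInfty F) (m : M),
      T^[n] (c • m) = c ^ Fintype.card F ^ n • T^[n] m := by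
    intro n
    induction n with
    | zero => intro c m; simp
    | succ n ih =>
      intro c m
      rw [Function.iterate_succ_apply, hT, ih, Function.iterate_succ_apply, ← pow_mul, ← pow_succ']
  induction f using SkewPolynomial.induction with
  | h0 => simp [twAct_zero_left]
  | ha n r p _ _ ih =>
    rw [add_mul, twAct_add_left, twAct_add_left, ih]
    congr 1
    clear ih
    induction g using SkewPolynomial.induction with
    | h0 => simp [twAct_zero_left, twAct_zero_right]
    | ha k s q _ _ ih =>
      rw [mul_add, twAct_add_left, ih, twAct_add_left, twAct_add_right]
      congr 1
      rw [SkewPolynomial.monomial_mul_monomial, twAct_monomial, twAct_monomial, twAct_monomial,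
        SkewPolynomial.φ_iterate_apply, twist_smul, hT', mul_smul, Function.iterate_add_apply]

end twAct

/-! ### `F_q`-linear entire functions -/

variable (F) in
/-- The `q`-Frobenius `τ`, as an additive map. -/
def frob : CInfty F →+ CInfty F := (FiniteField.frobeniusAlgHom F (CInfty F)).toLinearMap.toAddMonoidHom

lemma frob_iterate (n : ℕ) (x : CInfty F) : (frob F)^[n] x = x ^ Fintype.card F ^ n := by
  change (fun x : CInfty F => x ^ Fintype.card F)^[n] x = _
  rw [pow_iterate]

/-- The value at `x` of the twisted polynomial `∑ c_n τ ^ n` viewed as the `F_q`-linear map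
`x ↦ ∑ c_n x ^ (q ^ n)`. -/
def twEval (f : TwistedPolynomial F) (x : CInfty F) : CInfty F :=
  SkewPolynomial.sum f fun n c => c * x ^ Fintype.card F ^ n

lemma twEval_eq (f : TwistedPolynomial F) (x : CInfty F) : twEval f x = twAct (frob F) f x := by
  simp only [twEval, twAct, frob_iterate, smul_eq_mul]

lemma twEval_mul (f g : TwistedPolynomial F) (x : CInfty F) :
    twEval (f * g) x = twEval f (twEval g x) := by
  simp only [twEval_eq]
  exact twAct_mul _ (fun c m => mul_pow _ _ _) _ _ _

variable (F) in
/-- The coefficient sequences of `F_q`-linear entire functions: those `s` for which the series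
`∑ s_n z ^ (q ^ n)` has infinite radius of convergence. -/
def entireSeq : Submodule (CInfty F) (ℕ → CInfty F) where
  carrier := {s | ∀ R : ℝ, Tendsto (fun n => ‖s n‖ * R ^ Fintype.card F ^ n) atTop (𝓝 0)}
  zero_mem' R := by simp
  add_mem' {s t} hs ht R := by
    have h := ((hs |R|).add (ht |R|))
    rw [add_zero] at h
    refine squeeze_zero_norm (fun n => ?_) h
    rw [norm_mul, norm_norm, norm_pow, Real.norm_eq_abs, ← add_mul]
    gcongr
    exact norm_add_le _ _
  smul_mem' c s hs R := by
    simpa [mul_assoc] using (hs R).const_mul ‖c‖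

lemma mem_entireSeq {s : ℕ → CInfty F} : s ∈ entireSeq F ↔
    ∀ R : ℝ, Tendsto (fun n => ‖s n‖ * R ^ Fintype.card F ^ n) atTop (𝓝 0) := Iff.rfl

lemma mem_entireSeq_of_le {s t : ℕ → CInfty F} (hs : s ∈ entireSeq F) (h : ∀ n, ‖t n‖ ≤ ‖s n‖) :
    t ∈ entireSeq F := by
  intro R
  refine squeeze_zero_norm (fun n => ?_) (hs |R|)
  rw [norm_mul, norm_norm, norm_pow, Real.norm_eq_abs]
  gcongr
  exact h n

/-- The coefficient sequence of `f ^ q`, where `f` has coefficient sequence `s`. -/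
def shiftFrob (s : ℕ → CInfty F) : ℕ → CInfty F
  | 0 => 0
  | n + 1 => s n ^ Fintype.card F

lemma shiftFrob_mem {s : ℕ → CInfty F} (hs : s ∈ entireSeq F) : shiftFrob s ∈ entireSeq F := by
  intro R
  rw [← tendsto_add_atTop_iff_nat 1]
  have h := (hs R).pow (Fintype.card F)
  rw [zero_pow Fintype.card_ne_zero] at h
  refine h.congr fun n => ?_
  simp only [shiftFrob, norm_pow]
  rw [mul_pow, ← pow_mul, ← pow_succ]

variable (F) in
/-- `shiftFrob` on coefficient sequences of entire functions. -/
def shiftHom : entireSeq F →+ entireSeq F where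
  toFun s := ⟨shiftFrob s.1, shiftFrob_mem s.2⟩
  map_zero' := by
    ext n
    cases n with
    | zero => rfl
    | succ n => exact zero_pow Fintype.card_ne_zero
  map_add' s t := by
    ext n
    cases n with
    | zero => exact (add_zero 0).symm
    | succ n => exact map_add (frob F) (s.1 n) (t.1 n)

lemma shiftHom_smul (c : CInfty F) (s : entireSeq F) :
    shiftHom F (c • s) = c ^ Fintype.card F • shiftHom F s := by
  ext n
  cases n with
  | zero => exact (mul_zero _).symm
  | succ n => exact mul_pow _ _ _

lemma entireSeq_summable {s : ℕ → CInfty F} (hs : s ∈ entireSeq F) (z : CInfty F) :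
    Summable fun n => s n * z ^ Fintype.card F ^ n := by
  apply NonarchimedeanAddGroup.summable_of_tendsto_cofinite_zero
  rw [Nat.cofinite_eq_atTop, tendsto_zero_iff_norm_tendsto_zero]
  simpa using hs ‖z‖

/-- The value at `z` of the entire function `∑ s_n z ^ (q ^ n)`. -/
def seriesEval (z : CInfty F) : entireSeq F →ₗ[CInfty F] CInfty F where
  toFun s := ∑' n, s.1 n * z ^ Fintype.card F ^ n
  map_add' s t := by
    rw [← (entireSeq_summable s.2 z).tsum_add (entireSeq_summable t.2 z)]
    exact tsum_congr fun n => add_mul _ _ _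
  map_smul' c s := by
    rw [RingHom.id_apply, smul_eq_mul, ← (entireSeq_summable s.2 z).tsum_mul_left]
    exact tsum_congr fun n => mul_assoc _ _ _

lemma seriesEval_shift (z : CInfty F) (s : entireSeq F) :
    seriesEval z (shiftHom F s) = frob F (seriesEval z s) := by
  have hc : Continuous (frob F) := by
    change Continuous fun x : CInfty F => x ^ Fintype.card F
    fun_prop
  change ∑' n, shiftFrob s.1 n * z ^ Fintype.card F ^ n = frob F (∑' n, s.1 n * z ^ Fintype.card F ^ n)
  rw [(entireSeq_summable (shiftFrob_mem s.2) z).tsum_eq_zero_add,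
    (entireSeq_summable s.2 z).map_tsum (frob F) hc]
  simp only [shiftFrob, zero_mul, zero_add]
  refine tsum_congr fun n => ?_
  change _ = (s.1 n * z ^ Fintype.card F ^ n) ^ Fintype.card F
  rw [mul_pow, ← pow_mul, ← pow_succ]

lemma seriesEval_twAct (z : CInfty F) (f : TwistedPolynomial F) (s : entireSeq F) :
    seriesEval z (twAct (shiftHom F) f s) = twEval f (seriesEval z s) := by
  rw [twEval_eq]
  exact twAct_map _ _ _ (seriesEval_shift z) _ _

lemma seriesEval_add (z w : CInfty F) (s : entireSeq F) :
    seriesEval (z + w) s = seriesEval z s + seriesEval w s := by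
  change ∑' n, s.1 n * (z + w) ^ Fintype.card F ^ n
    = ∑' n, s.1 n * z ^ Fintype.card F ^ n + ∑' n, s.1 n * w ^ Fintype.card F ^ n
  rw [← (entireSeq_summable s.2 z).tsum_add (entireSeq_summable s.2 w)]
  refine tsum_congr fun n => ?_
  rw [← mul_add, ← frob_iterate, iterate_map_add, frob_iterate, frob_iterate]

lemma seriesEval_smul (c : F) (z : CInfty F) (s : entireSeq F) :
    seriesEval (c • z) s = c • seriesEval z s := by
  rw [Algebra.smul_def c (seriesEval z s), ← smul_eq_mul, ← map_smul]
  change ∑' n, s.1 n * (c • z) ^ Fintype.card F ^ n =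
    ∑' n, (algebraMap F (CInfty F) c * s.1 n) * z ^ Fintype.card F ^ n
  refine tsum_congr fun n => ?_
  rw [_root_.smul_pow, FiniteField.pow_card_pow, mul_smul_comm, Algebra.smul_def, ← mul_assoc]

lemma twAct_shift_apply (f : TwistedPolynomial F) (s : entireSeq F) (n : ℕ) :
    (twAct (shiftHom F) f s).1 n
      = ∑ j ∈ Finset.range (n + 1),
          SkewPolynomial.coeff f j * s.1 (n - j) ^ Fintype.card F ^ j := by
  have key : ∀ (k n : ℕ), (((shiftHom F)^[k] s : entireSeq F)).1 n
      = if k ≤ n then s.1 (n - k) ^ Fintype.card F ^ k else 0 := by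
    intro k
    induction k with
    | zero => intro n; simp
    | succ k ih =>
      intro n
      rw [Function.iterate_succ_apply']
      cases n with
      | zero => rfl
      | succ n =>
        change (_ : CInfty F) ^ Fintype.card F = _
        rw [ih]
        split_ifs with h1 h2 h2
        · rw [← pow_mul, ← pow_succ, Nat.add_sub_add_right]
        · omega
        · omega
        · exact zero_pow Fintype.card_ne_zero
  induction f using SkewPolynomial.induction with
  | h0 => simp [twAct_zero_left]
  | ha k r q _ _ ih =>
    simp only [twAct_add_left, twAct_monomial, SkewPolynomial.coeff_add, add_mul,
      Finset.sum_add_distrib, ← ih, SkewPolynomial.coeff_monomial]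
    change r * _ + _ = _
    congr 1
    rw [key]
    simp only [ite_mul, zero_mul, Finset.sum_ite_eq, Finset.mem_range, mul_ite, mul_zero,
      Nat.lt_succ_iff]


/-! ### Drinfeld modules -/

variable (F) in
/-- A Drinfeld `A`-module of rank `r` over `C_∞` (for `1 ≤ r`): a homomorphism of `F_q`-algebras
`a ↦ φ_a` from `A` to `C_∞{τ}` such that `φ_a` has constant term `a`, and
`φ_θ = θ + g_1 τ + ⋯ + g_r τ ^ r` with `g_r ≠ 0`. -/
structure DrinfeldModule (r : ℕ) where
  /-- The homomorphism `a ↦ φ_a`. -/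
  toAlgHom : F[X] →ₐ[F] TwistedPolynomial F
  coeff_zero : ∀ a : F[X],
    SkewPolynomial.coeff (toAlgHom a) 0 = algebraMap F[X] (CInfty F) a
  coeff_rank_ne_zero : SkewPolynomial.coeff (toAlgHom Polynomial.X) r ≠ 0
  coeff_eq_zero_of_lt : ∀ n, r < n → SkewPolynomial.coeff (toAlgHom Polynomial.X) n = 0

namespace DrinfeldModule

variable {r : ℕ} (φ : DrinfeldModule F r)

/-- The coefficients `α_n` of the exponential function of `φ`, determined by `α_0 = 1` and the
identity `α_n θ ^ (q ^ n) = ∑_{j ≤ n} g_j α_{n - j} ^ (q ^ j)`, where `φ_θ = ∑ g_j τ ^ j` and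
`g_0 = θ`; that is, by `e_φ(θ z) = φ_θ(e_φ(z))`. -/
def expCoeff : ℕ → CInfty F
  | 0 => 1
  | n + 1 => (θ F ^ Fintype.card F ^ (n + 1) - θ F)⁻¹ *
      ∑ j : Fin (n + 1), SkewPolynomial.coeff (φ.toAlgHom Polynomial.X) (j + 1) *
        expCoeff (n - j) ^ Fintype.card F ^ (j + 1 : ℕ)

lemma norm_θ_pow_sub (n : ℕ) :
    ‖θ F ^ Fintype.card F ^ (n + 1) - θ F‖ = (Fintype.card F : ℝ) ^ Fintype.card F ^ (n + 1) := by
  have hq : (1 : ℝ) < Fintype.card F := by exact_mod_cast Fintype.one_lt_card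
  have h : ‖θ F‖ < ‖θ F ^ Fintype.card F ^ (n + 1)‖ := by
    rw [norm_pow, norm_θ]
    exact lt_self_pow₀ hq (Nat.one_lt_pow (by omega) Fintype.one_lt_card)
  rw [sub_eq_add_neg, IsUltrametricDist.norm_add_eq_max_of_norm_ne_norm (by rw [norm_neg]; exact h.ne'),
    norm_neg, max_eq_left h.le, norm_pow, norm_θ]

lemma θ_pow_sub_ne_zero (n : ℕ) : θ F ^ Fintype.card F ^ (n + 1) - θ F ≠ 0 := by
  rw [← norm_ne_zero_iff, norm_θ_pow_sub]
  have : (0 : ℝ) < Fintype.card F := by exact_mod_cast Fintype.card_pos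
  positivity

lemma norm_expCoeff_succ_le (G μ : ℝ) (hG : 1 ≤ G) (hμ : 0 < μ) (hμ1 : μ ≤ 1)
    (hμr : 1 ≤ Fintype.card F * μ ^ (r + 1))
    (hφ : ∀ j, ‖SkewPolynomial.coeff (φ.toAlgHom Polynomial.X) j‖ ≤ G) (n : ℕ) :
    ‖φ.expCoeff n‖ ≤ G ^ (Fintype.card F ^ n - 1) * (μ ^ n) ^ Fintype.card F ^ n := by
  have hq2 : 2 ≤ Fintype.card F := Fintype.one_lt_card
  have hq : (1 : ℝ) < Fintype.card F := by exact_mod_cast Fintype.one_lt_card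
  induction n using Nat.strong_induction_on with
  | _ n ih =>
  cases n with
  | zero => simp [expCoeff]
  | succ n =>
    set q := Fintype.card F with hqdef
    rw [expCoeff, norm_mul, norm_inv, norm_θ_pow_sub, inv_mul_le_iff₀ (by positivity)]
    refine IsUltrametricDist.norm_sum_le_of_forall_le_of_nonneg (by positivity) fun j _ => ?_
    by_cases hj : r < (j : ℕ) + 1
    · rw [φ.coeff_eq_zero_of_lt _ hj, zero_mul, norm_zero]
      positivity
    push Not at hj
    have hjn : (j : ℕ) ≤ n := by omega
    rw [norm_mul, norm_pow]
    have h1 := ih (n - j) (by omega)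
    calc _ ≤ G * (G ^ (q ^ (n - j) - 1) * (μ ^ (n - j)) ^ q ^ (n - j)) ^ q ^ ((j : ℕ) + 1) := by
          gcongr
          exact hφ _
      _ = G ^ (1 + (q ^ (n - j) - 1) * q ^ ((j : ℕ) + 1)) * (μ ^ (n - j)) ^ q ^ (n + 1) := by
          rw [mul_pow, ← pow_mul G, ← pow_mul (μ ^ _), ← pow_add, pow_add G, pow_one, mul_assoc]
          congr 4
          omega
      _ ≤ G ^ (q ^ (n + 1) - 1) * ((q : ℝ) * μ ^ (n + 1)) ^ q ^ (n + 1) := by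
          gcongr ?_ * ?_ ^ _
          · apply pow_le_pow_right₀ hG
            have e : q ^ (n - j) * q ^ ((j : ℕ) + 1) = q ^ (n + 1) := by
              rw [← pow_add]; congr 1; omega
            have e2 : 2 ≤ q ^ ((j : ℕ) + 1) :=
              hq2.trans (Nat.le_self_pow (by omega) q)
            have e3 : q ^ ((j : ℕ) + 1) ≤ q ^ (n + 1) :=
              Nat.pow_le_pow_right (by omega) (by omega)
            rw [Nat.sub_mul, e, one_mul]
            omega
          · calc μ ^ (n - j) = 1 * μ ^ (n - j) := (one_mul _).symm
              _ ≤ (q * μ ^ (r + 1)) * μ ^ (n - j) := by gcongr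
              _ = q * μ ^ (r + 1 + (n - j)) := by rw [mul_assoc, ← pow_add]
              _ ≤ q * μ ^ (n + 1) := by
                  gcongr ?_ * ?_
                  exact pow_le_pow_of_le_one hμ.le hμ1 (show n + 1 ≤ r + 1 + (n - j) by omega)
      _ = _ := by rw [mul_pow]; ring

lemma expCoeff_mem : φ.expCoeff ∈ entireSeq F := by
  have hq2 : 2 ≤ Fintype.card F := Fintype.one_lt_card
  have hq : (1 : ℝ) < Fintype.card F := by exact_mod_cast Fintype.one_lt_card
  obtain ⟨G, hG, hφ⟩ : ∃ G : ℝ, 1 ≤ G ∧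
      ∀ j, ‖SkewPolynomial.coeff (φ.toAlgHom Polynomial.X) j‖ ≤ G := by
    refine ⟨1 + ∑ j ∈ Finset.range (r + 1), ‖SkewPolynomial.coeff (φ.toAlgHom Polynomial.X) j‖,
      le_add_of_nonneg_right (Finset.sum_nonneg fun _ _ => norm_nonneg _), fun j => ?_⟩
    by_cases hj : r < j
    · rw [φ.coeff_eq_zero_of_lt _ hj, norm_zero]
      positivity
    · refine le_trans (Finset.single_le_sum
        (f := fun j => ‖SkewPolynomial.coeff (φ.toAlgHom Polynomial.X) j‖)
        (fun _ _ => norm_nonneg _) (Finset.mem_range.2 (show j < r + 1 by omega))) ?_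
      simp
  set μ : ℝ := ((Fintype.card F : ℝ)⁻¹) ^ (((r + 1 : ℕ) : ℝ)⁻¹) with hμdef
  have hμ : 0 < μ := by positivity
  have hμ1 : μ < 1 := Real.rpow_lt_one (by positivity) (inv_lt_one_of_one_lt₀ hq) (by positivity)
  have hμr : μ ^ (r + 1) = (Fintype.card F : ℝ)⁻¹ :=
    Real.rpow_inv_natCast_pow (by positivity) (by omega)
  have hb := φ.norm_expCoeff_succ_le G μ hG hμ hμ1.le
    (by rw [hμr, mul_inv_cancel₀ (by positivity)]) hφ
  intro R
  have hlim : Tendsto (fun n => G * |R| * μ ^ n) atTop (𝓝 0) := by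
    simpa using (tendsto_pow_atTop_nhds_zero_of_lt_one hμ.le hμ1).const_mul (G * |R|)
  have hhalf : Tendsto (fun n : ℕ => (1 / 2 : ℝ) ^ Fintype.card F ^ n) atTop (𝓝 0) :=
    (tendsto_pow_atTop_nhds_zero_of_lt_one (by norm_num) (by norm_num)).comp
      (tendsto_pow_atTop_atTop_of_one_lt (by omega))
  refine squeeze_zero_norm' ?_ hhalf
  filter_upwards [hlim.eventually_le_const (show (0 : ℝ) < 1 / 2 by norm_num)] with n hn
  rw [norm_mul, norm_norm, norm_pow, Real.norm_eq_abs]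
  calc _ ≤ (G ^ (Fintype.card F ^ n) * (μ ^ n) ^ Fintype.card F ^ n) * |R| ^ Fintype.card F ^ n := by
        gcongr
        refine (hb n).trans ?_
        gcongr
        exacts [Nat.sub_le _ _]
    _ = (G * |R| * μ ^ n) ^ Fintype.card F ^ n := by rw [mul_pow, mul_pow]; ring
    _ ≤ _ := by gcongr

/-- The coefficients of the exponential function, as those of an entire function. -/
def expSeq : entireSeq F := ⟨φ.expCoeff, φ.expCoeff_mem⟩

/-- The exponential function `e_φ(z) = ∑ α_n z ^ (q ^ n)` of `φ`. -/
def exp (z : CInfty F) : CInfty F := ∑' n, φ.expCoeff n * z ^ Fintype.card F ^ n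

lemma exp_eq (z : CInfty F) : φ.exp z = seriesEval z φ.expSeq := rfl

lemma coeff_X_zero : SkewPolynomial.coeff (φ.toAlgHom Polynomial.X) 0 = θ F := φ.coeff_zero _

lemma twAct_expSeq (n : ℕ) : (twAct (shiftHom F) (φ.toAlgHom Polynomial.X) φ.expSeq).1 n
    = θ F ^ Fintype.card F ^ n * φ.expCoeff n := by
  rw [twAct_shift_apply]
  change ∑ j ∈ _, _ * φ.expCoeff _ ^ _ = _
  cases n with
  | zero => simp [coeff_X_zero]
  | succ n =>
    have h : (θ F ^ Fintype.card F ^ (n + 1) - θ F) * φ.expCoeff (n + 1) =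
        ∑ j : Fin (n + 1), SkewPolynomial.coeff (φ.toAlgHom Polynomial.X) (j + 1) *
        φ.expCoeff (n - j) ^ Fintype.card F ^ (j + 1 : ℕ) := by
      rw [expCoeff, mul_inv_cancel_left₀ (θ_pow_sub_ne_zero n)]
    rw [Finset.sum_range_succ', coeff_X_zero]
    rw [Fin.sum_univ_eq_sum_range (fun j => SkewPolynomial.coeff (φ.toAlgHom Polynomial.X) (j + 1) *
        φ.expCoeff (n - j) ^ Fintype.card F ^ (j + 1 : ℕ))] at h
    simp only [Nat.add_sub_add_right, Nat.sub_zero, pow_zero, pow_one]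
    rw [← h]
    ring

lemma exp_add (z w : CInfty F) : φ.exp (z + w) = φ.exp z + φ.exp w := by
  simp only [exp_eq, seriesEval_add]

lemma exp_smul (c : F) (z : CInfty F) : φ.exp (c • z) = c • φ.exp z := by
  simp only [exp_eq, seriesEval_smul]

lemma exp_θ_mul (z : CInfty F) :
    φ.exp (θ F * z) = twEval (φ.toAlgHom Polynomial.X) (φ.exp z) := by
  rw [exp_eq, exp_eq, ← seriesEval_twAct]
  change ∑' n, φ.expCoeff n * (θ F * z) ^ _ = ∑' n, _ * z ^ _
  refine tsum_congr fun n => ?_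
  rw [twAct_expSeq, mul_pow]
  ring

lemma twEval_algebraMap (c : F) (x : CInfty F) :
    twEval (algebraMap F (TwistedPolynomial F) c) x = c • x := by
  rw [twEval_eq]
  change twAct _ (SkewPolynomial.monomial 0 (algebraMap F (CInfty F) c)) x = _
  rw [twAct_monomial, Algebra.smul_def]
  rfl

/-- `e_φ(a z) = φ_a(e_φ(z))` for all `a` in `A`. -/
theorem exp_algebraMap_mul (a : F[X]) (z : CInfty F) :
    φ.exp (a • z) = twEval (φ.toAlgHom a) (φ.exp z) := by
  induction a using Polynomial.induction_on generalizing z with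
  | C c =>
    rw [← Polynomial.algebraMap_eq, algebraMap_smul, AlgHom.commutes, twEval_algebraMap, exp_smul]
  | add p q hp hq =>
    rw [add_smul, exp_add, hp, hq, map_add, twEval_eq, twEval_eq, twEval_eq, twAct_add_left]
  | monomial n c ih =>
    rw [pow_succ, ← mul_assoc, mul_smul, ih, map_mul φ.toAlgHom (_ * _), twEval_mul, ← exp_θ_mul,
      Algebra.smul_def]
    rfl

/-- The period lattice `Λ` of `φ`: the kernel of the exponential function, an `A`-submodule of
`C_∞`. -/
def periodLattice : Submodule F[X] (CInfty F) where
  carrier := {z | φ.exp z = 0}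
  zero_mem' := by
    change φ.exp 0 = 0
    simpa using φ.exp_smul 0 0
  add_mem' {z w} hz hw := by
    change φ.exp (z + w) = 0
    rw [exp_add, show φ.exp z = 0 from hz, show φ.exp w = 0 from hw, add_zero]
  smul_mem' a z hz := by
    change φ.exp (a • z) = 0
    rw [exp_algebraMap_mul, show φ.exp z = 0 from hz, twEval_eq, twAct_zero_right]

lemma mem_periodLattice {z : CInfty F} : z ∈ φ.periodLattice ↔ φ.exp z = 0 := Iff.rfl

/-! ### De Rham cohomology and the de Rham morphism -/

/-- The `F_q`-linear biderivations of `φ`: the `F_q`-linear maps `δ : A → C_∞{τ} τ` such that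
`δ_{ab} = a δ_b + δ_a φ_b`. They form a `C_∞`-vector space under left multiplication. -/
def biderivations : Submodule (CInfty F) (F[X] →ₗ[F] TwistedPolynomial F) where
  carrier := {δ | (∀ a, SkewPolynomial.coeff (δ a) 0 = 0) ∧
    ∀ a b, δ (a * b) = algebraMap F[X] (CInfty F) a • δ b + δ a * φ.toAlgHom b}
  zero_mem' := by simp
  add_mem' {δ ε} hδ hε := by
    refine ⟨fun a => ?_, fun a b => ?_⟩
    · rw [LinearMap.add_apply, SkewPolynomial.coeff_add, hδ.1, hε.1, add_zero]
    · simp only [LinearMap.add_apply, hδ.2, hε.2, smul_add, add_mul]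
      abel
  smul_mem' c δ hδ := by
    refine ⟨fun a => ?_, fun a b => ?_⟩
    · change c * SkewPolynomial.coeff (δ a) 0 = 0
      rw [hδ.1, mul_zero]
    · simp only [LinearMap.smul_apply, hδ.2, smul_add]
      rw [smul_comm c, smul_mul_assoc]


/-- The `C_∞`-vector space of biderivations of `φ`. -/
def Biderivation : Type _ := φ.biderivations

instance : AddCommGroup φ.Biderivation := inferInstanceAs (AddCommGroup φ.biderivations)

instance : Module (CInfty F) φ.Biderivation :=
  inferInstanceAs (Module (CInfty F) φ.biderivations)

/-- `C_∞{τ} τ`, the twisted polynomials without constant term. -/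
def augmentation (F : Type*) [Field F] [Fintype F] :
    Submodule (CInfty F) (TwistedPolynomial F) where
  carrier := {m | SkewPolynomial.coeff m 0 = 0}
  zero_mem' := rfl
  add_mem' {m n} hm hn := by
    change SkewPolynomial.coeff (m + n) 0 = 0
    rw [SkewPolynomial.coeff_add, show SkewPolynomial.coeff m 0 = 0 from hm,
      show SkewPolynomial.coeff n 0 = 0 from hn, add_zero]
  smul_mem' c m hm := by
    change c * SkewPolynomial.coeff m 0 = 0
    rw [show SkewPolynomial.coeff m 0 = 0 from hm, mul_zero]

lemma coeff_mul_zero (f g : TwistedPolynomial F) :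
    SkewPolynomial.coeff (f * g) 0 = SkewPolynomial.coeff f 0 * SkewPolynomial.coeff g 0 := by
  induction f using SkewPolynomial.induction with
  | h0 => simp
  | ha n r p _ _ ih =>
    rw [add_mul, SkewPolynomial.coeff_add, ih, SkewPolynomial.coeff_add, add_mul]
    congr 1
    clear ih
    induction g using SkewPolynomial.induction with
    | h0 => simp
    | ha k s q _ _ ih =>
      rw [mul_add, SkewPolynomial.coeff_add, ih, SkewPolynomial.coeff_add, mul_add]
      congr 1
      rw [SkewPolynomial.monomial_mul_monomial, SkewPolynomial.φ_iterate_apply, twist_smul]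
      simp only [SkewPolynomial.coeff_monomial]
      rcases n.eq_zero_or_pos with rfl | hn
      · simp
      · simp [hn.ne']

/-- The strictly inner biderivation `a ↦ a m - m φ_a` attached to `m` in `C_∞{τ} τ`. -/
def strictlyInnerOf : augmentation F →ₗ[CInfty F] φ.Biderivation where
  toFun m := ⟨{
      toFun a := algebraMap F[X] (CInfty F) a • m.1 - m.1 * φ.toAlgHom a
      map_add' a b := by simp only [map_add, add_smul, mul_add]; abel
      map_smul' c a := by
        have h : algebraMap F[X] (CInfty F) (c • a) = c • algebraMap F[X] (CInfty F) a := by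
          rw [Algebra.algebraMap_eq_smul_one, Algebra.algebraMap_eq_smul_one, smul_assoc]
        rw [h, map_smul φ.toAlgHom, mul_smul_comm, RingHom.id_apply, smul_sub, smul_assoc] },
    fun a => by
      change SkewPolynomial.coeff (algebraMap F[X] (CInfty F) a • m.1 - m.1 * φ.toAlgHom a) 0 = 0
      rw [SkewPolynomial.coeff_sub, coeff_mul_zero,
        show SkewPolynomial.coeff m.1 0 = 0 from m.2, zero_mul, sub_zero]
      exact (augmentation F).smul_mem _ m.2,
    fun a b => by
      change algebraMap F[X] (CInfty F) (a * b) • m.1 - m.1 * φ.toAlgHom (a * b)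
        = algebraMap F[X] (CInfty F) a •
            (algebraMap F[X] (CInfty F) b • m.1 - m.1 * φ.toAlgHom b)
          + (algebraMap F[X] (CInfty F) a • m.1 - m.1 * φ.toAlgHom a) * φ.toAlgHom b
      rw [map_mul, map_mul, mul_smul, smul_sub, sub_mul, smul_mul_assoc, mul_assoc]
      abel⟩
  map_add' m n := by
    refine Subtype.ext (LinearMap.ext fun a => ?_)
    change algebraMap F[X] (CInfty F) a • (m.1 + n.1) - (m.1 + n.1) * φ.toAlgHom a
      = (algebraMap F[X] (CInfty F) a • m.1 - m.1 * φ.toAlgHom a)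
        + (algebraMap F[X] (CInfty F) a • n.1 - n.1 * φ.toAlgHom a)
    rw [smul_add, add_mul]
    abel
  map_smul' c m := by
    refine Subtype.ext (LinearMap.ext fun a => ?_)
    change algebraMap F[X] (CInfty F) a • (c • m.1) - (c • m.1) * φ.toAlgHom a
      = c • (algebraMap F[X] (CInfty F) a • m.1 - m.1 * φ.toAlgHom a)
    rw [smul_sub, smul_comm c, smul_mul_assoc]

/-- The subspace of strictly inner biderivations. -/
def strictlyInner : Submodule (CInfty F) φ.Biderivation := LinearMap.range φ.strictlyInnerOf

/-- The de Rham cohomology `H¹_DR(φ)`: biderivations modulo strictly inner ones. -/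
abbrev H1DR : Type _ := φ.Biderivation ⧸ φ.strictlyInner

/-- The coefficients `c_n` of the entire function `F_δ` attached to `δ`, determined by `c_0 = 0` and
the identity `c_n (θ ^ (q ^ n) - θ) = ∑_{j ≤ n} d_j α_{n - j} ^ (q ^ j)`, where
`δ_θ = ∑ d_j τ ^ j`; that is, by `F_δ(θ z) = θ F_δ(z) + δ_θ(e_φ(z))`. -/
def quasiCoeff (δ : φ.Biderivation) : ℕ → CInfty F
  | 0 => 0
  | n + 1 => (θ F ^ Fintype.card F ^ (n + 1) - θ F)⁻¹ *
      ∑ j ∈ Finset.range (n + 2), SkewPolynomial.coeff (δ.1 Polynomial.X) j *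
        φ.expCoeff (n + 1 - j) ^ Fintype.card F ^ j

/-- The entire function `F_δ(z) = ∑ c_n z ^ (q ^ n)` attached to the biderivation `δ`: the unique
`F_q`-linear entire function without linear term such that
`F_δ(a z) = a F_δ(z) + δ_a(e_φ(z))` for all `a` in `A`. -/
def quasiPeriodicFun (δ : φ.Biderivation) (z : CInfty F) : CInfty F :=
  ∑' n, φ.quasiCoeff δ n * z ^ Fintype.card F ^ n

lemma quasiCoeff_succ (δ : φ.Biderivation) (n : ℕ) :
    φ.quasiCoeff δ (n + 1) = (θ F ^ Fintype.card F ^ (n + 1) - θ F)⁻¹ *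
      (twAct (shiftHom F) (δ.1 Polynomial.X) φ.expSeq).1 (n + 1) := by
  rw [twAct_shift_apply]
  rfl

lemma quasiCoeff_mem (δ : φ.Biderivation) : φ.quasiCoeff δ ∈ entireSeq F := by
  refine mem_entireSeq_of_le (twAct (shiftHom F) (δ.1 Polynomial.X) φ.expSeq).2 fun n => ?_
  cases n with
  | zero => exact (norm_zero (E := CInfty F)).trans_le (norm_nonneg _)
  | succ n =>
    have hq : (1 : ℝ) < Fintype.card F := by exact_mod_cast Fintype.one_lt_card
    rw [quasiCoeff_succ, norm_mul, norm_inv, norm_θ_pow_sub]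
    exact mul_le_of_le_one_left (norm_nonneg _) (inv_le_one_of_one_le₀ (one_le_pow₀ hq.le))

/-- The linear dependence of the coefficients of `F_δ` on `δ`. -/
def quasiSeq : φ.Biderivation →ₗ[CInfty F] entireSeq F where
  toFun δ := ⟨φ.quasiCoeff δ, φ.quasiCoeff_mem δ⟩
  map_add' δ ε := by
    ext n
    change φ.quasiCoeff (δ + ε) n = φ.quasiCoeff δ n + φ.quasiCoeff ε n
    cases n with
    | zero => exact (add_zero 0).symm
    | succ n =>
      rw [quasiCoeff_succ, quasiCoeff_succ, quasiCoeff_succ, ← mul_add]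
      congr 1
      change (twAct (shiftHom F) (δ.1 Polynomial.X + ε.1 Polynomial.X) φ.expSeq).1 (n + 1) = _
      rw [twAct_add_left]
      rfl
  map_smul' c δ := by
    ext n
    change φ.quasiCoeff (c • δ) n = c * φ.quasiCoeff δ n
    cases n with
    | zero => exact (mul_zero c).symm
    | succ n =>
      rw [quasiCoeff_succ, quasiCoeff_succ, mul_left_comm]
      congr 1
      change (twAct (shiftHom F) (c • δ.1 Polynomial.X) φ.expSeq).1 (n + 1) = _
      rw [twAct_smul_left]
      rfl

lemma quasiPeriodicFun_eq (δ : φ.Biderivation) (z : CInfty F) :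
    φ.quasiPeriodicFun δ z = seriesEval z (φ.quasiSeq δ) := rfl

lemma quasiPeriodicFun_add (δ : φ.Biderivation) (z w : CInfty F) :
    φ.quasiPeriodicFun δ (z + w) = φ.quasiPeriodicFun δ z + φ.quasiPeriodicFun δ w := by
  simp only [quasiPeriodicFun_eq, seriesEval_add]

lemma quasiPeriodicFun_smul (δ : φ.Biderivation) (c : F) (z : CInfty F) :
    φ.quasiPeriodicFun δ (c • z) = c • φ.quasiPeriodicFun δ z := by
  simp only [quasiPeriodicFun_eq, seriesEval_smul]

lemma quasiCoeff_rel (δ : φ.Biderivation) (n : ℕ) :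
    θ F ^ Fintype.card F ^ n * φ.quasiCoeff δ n = θ F * φ.quasiCoeff δ n
      + (twAct (shiftHom F) (δ.1 Polynomial.X) φ.expSeq).1 n := by
  cases n with
  | zero =>
    have h : (twAct (shiftHom F) (δ.1 Polynomial.X) φ.expSeq).1 0 = 0 := by
      rw [twAct_shift_apply]
      simp [δ.2.1 Polynomial.X]
    rw [h]
    simp [quasiCoeff]
  | succ n =>
    rw [← sub_eq_iff_eq_add', ← sub_mul, quasiCoeff_succ,
      mul_inv_cancel_left₀ (θ_pow_sub_ne_zero n)]

lemma quasiPeriodicFun_θ_mul (δ : φ.Biderivation) (z : CInfty F) :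
    φ.quasiPeriodicFun δ (θ F * z)
      = θ F * φ.quasiPeriodicFun δ z + twEval (δ.1 Polynomial.X) (φ.exp z) := by
  rw [exp_eq, ← seriesEval_twAct, quasiPeriodicFun_eq, quasiPeriodicFun_eq,
    ← smul_eq_mul (θ F) (seriesEval _ _), ← map_smul, ← map_add]
  change ∑' n, φ.quasiCoeff δ n * (θ F * z) ^ Fintype.card F ^ n
    = ∑' n, (θ F * φ.quasiCoeff δ n
      + (twAct (shiftHom F) (δ.1 Polynomial.X) φ.expSeq).1 n) * z ^ Fintype.card F ^ n
  refine tsum_congr fun n => ?_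
  rw [← quasiCoeff_rel, mul_pow]
  ring

/-- `F_δ(a z) = a F_δ(z) + δ_a(e_φ(z))` for all `a` in `A`. -/
theorem quasiPeriodicFun_algebraMap_mul (δ : φ.Biderivation) (a : F[X]) (z : CInfty F) :
    φ.quasiPeriodicFun δ (a • z) = a • φ.quasiPeriodicFun δ z + twEval (δ.1 a) (φ.exp z) := by
  have hmul : ∀ a b : F[X],
      (∀ z, φ.quasiPeriodicFun δ (a • z)
        = a • φ.quasiPeriodicFun δ z + twEval (δ.1 a) (φ.exp z)) →
      (∀ z, φ.quasiPeriodicFun δ (b • z)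
        = b • φ.quasiPeriodicFun δ z + twEval (δ.1 b) (φ.exp z)) →
      ∀ z, φ.quasiPeriodicFun δ ((a * b) • z)
        = (a * b) • φ.quasiPeriodicFun δ z + twEval (δ.1 (a * b)) (φ.exp z) := by
    intro a b ha hb z
    rw [mul_smul, ha, hb, exp_algebraMap_mul, ← twEval_mul, δ.2.2, mul_smul, smul_add, twEval_eq,
      twEval_eq, twEval_eq, twAct_add_left, twAct_smul_left, add_assoc, smul_eq_mul,
      ← Algebra.smul_def]
  have hone : δ.1 1 = 0 := by
    have h := δ.2.2 1 1
    rw [mul_one, map_one φ.toAlgHom, map_one (algebraMap F[X] (CInfty F)), one_smul, mul_one] at h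
    exact left_eq_add.1 h
  induction a using Polynomial.induction_on generalizing z with
  | C c =>
    have h : δ.1 (Polynomial.C c) = 0 := by
      rw [← mul_one (Polynomial.C c), ← Polynomial.smul_eq_C_mul, map_smul, hone, smul_zero]
    rw [h, twEval_eq, twAct_zero_left, add_zero, ← Polynomial.algebraMap_eq, algebraMap_smul,
      algebraMap_smul, quasiPeriodicFun_smul]
  | add p q hp hq =>
    rw [add_smul, quasiPeriodicFun_add, hp, hq, map_add, twEval_eq, twEval_eq, twEval_eq,
      twAct_add_left, add_smul]
    abel
  | monomial n c ih =>
    rw [pow_succ, ← mul_assoc]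
    refine hmul _ _ ih (fun z => ?_) z
    rw [Algebra.smul_def, Algebra.smul_def]
    exact φ.quasiPeriodicFun_θ_mul δ z

/-- The entire function attached to `a ↦ a m - m φ_a` is `z ↦ -m(e_φ(z))`. -/
lemma quasiPeriodicFun_strictlyInnerOf (m : augmentation F) (z : CInfty F) :
    φ.quasiPeriodicFun (φ.strictlyInnerOf m) z = -twEval m.1 (φ.exp z) := by
  rw [quasiPeriodicFun_eq, exp_eq, ← seriesEval_twAct, ← map_neg]
  congr 1
  ext n
  change φ.quasiCoeff (φ.strictlyInnerOf m) n = -(twAct (shiftHom F) m.1 φ.expSeq).1 n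
  cases n with
  | zero =>
    rw [twAct_shift_apply]
    simp [quasiCoeff, show SkewPolynomial.coeff m.1 0 = 0 from m.2]
  | succ n =>
    rw [quasiCoeff_succ, inv_mul_eq_iff_eq_mul₀ (θ_pow_sub_ne_zero n)]
    have h : (φ.strictlyInnerOf m).1 Polynomial.X + m.1 * φ.toAlgHom Polynomial.X = θ F • m.1 :=
      sub_add_cancel _ _
    have h2 := congrArg (fun f => (twAct (shiftHom F) f φ.expSeq).1 (n + 1)) h
    simp only [twAct_add_left, twAct_smul_left,
      twAct_mul _ shiftHom_smul] at h2
    have h3 : (twAct (shiftHom F) m.1 (twAct (shiftHom F) (φ.toAlgHom Polynomial.X) φ.expSeq)).1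
        (n + 1) = θ F ^ Fintype.card F ^ (n + 1) * (twAct (shiftHom F) m.1 φ.expSeq).1 (n + 1) := by
      rw [twAct_shift_apply, twAct_shift_apply, Finset.mul_sum]
      refine Finset.sum_congr rfl fun j hj => ?_
      rw [twAct_expSeq, mul_pow, ← pow_mul, ← pow_add,
        Nat.sub_add_cancel (Nat.lt_succ_iff.1 (Finset.mem_range.1 hj)), mul_left_comm]
      rfl
    have h4 : (twAct (shiftHom F) ((φ.strictlyInnerOf m).1 Polynomial.X) φ.expSeq).1 (n + 1)
        + (twAct (shiftHom F) m.1 (twAct (shiftHom F) (φ.toAlgHom Polynomial.X) φ.expSeq)).1 (n + 1)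
        = θ F * (twAct (shiftHom F) m.1 φ.expSeq).1 (n + 1) := h2
    rw [h3] at h4
    linear_combination h4

/-- The map `δ ↦ F_δ|_Λ` on biderivations. -/
def periodMap : φ.Biderivation →ₗ[CInfty F] (φ.periodLattice →ₗ[F[X]] CInfty F) where
  toFun δ :=
    { toFun z := φ.quasiPeriodicFun δ z
      map_add' z w := φ.quasiPeriodicFun_add δ z w
      map_smul' a z := by
        rw [RingHom.id_apply]
        change φ.quasiPeriodicFun δ (a • (z : CInfty F)) = _
        rw [quasiPeriodicFun_algebraMap_mul, show φ.exp z = 0 from z.2, twEval_eq,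
          twAct_zero_right, add_zero] }
  map_add' δ ε := by
    ext z
    change φ.quasiPeriodicFun (δ + ε) z = φ.quasiPeriodicFun δ z + φ.quasiPeriodicFun ε z
    simp only [quasiPeriodicFun_eq, map_add]
  map_smul' c δ := by
    ext z
    change φ.quasiPeriodicFun (c • δ) z = c • φ.quasiPeriodicFun δ z
    simp only [quasiPeriodicFun_eq, map_smul]

/-- The de Rham morphism (cycle class map) `DR : H¹_DR(φ) → Hom_A(Λ, C_∞)`, `[δ] ↦ F_δ|_Λ`. -/
def deRhamMap : φ.H1DR →ₗ[CInfty F] (φ.periodLattice →ₗ[F[X]] CInfty F) :=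
  φ.strictlyInner.liftQ φ.periodMap <| by
    rintro _ ⟨m, rfl⟩
    rw [LinearMap.mem_ker]
    ext z
    change φ.quasiPeriodicFun (φ.strictlyInnerOf m) z = 0
    rw [quasiPeriodicFun_strictlyInnerOf, show φ.exp z = 0 from z.2, twEval_eq, twAct_zero_right, neg_zero]

@[simp] lemma deRhamMap_mk (δ : φ.Biderivation) (z : φ.periodLattice) :
    φ.deRhamMap (Submodule.Quotient.mk δ) z = φ.quasiPeriodicFun δ z := rfl

end DrinfeldModule

end DrinfeldDeRham

end

/-! Call a biderivation δ reduced if δ_θ has degree at most r. Subtracting strictly inner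
biderivations kills the higher coefficients of δ_θ, because g_r ≠ 0 makes the leading term of m φ_θ
controllable (`exists_sub_strictlyInnerOf`). So it suffices to show that δ ↦ F_δ|_Λ is bijective on
reduced biderivations.

Injectivity is a growth argument (`quasiCoeff_eq_zero`). Write M(ρ) for the Gauss norm of e_φ on the
disc of radius ρ. From F_δ(θz) - θF_δ(z) = δ_θ(e_φ(z)) the Gauss norm of F_δ at radius qρ is at most
a constant times M(ρ)^(q^r). For large ρ the leading term of φ_θ dominates, so M(qρ) is at least
|g_r| M(ρ)^(q^r). Hence F_δ grows no faster than e_φ. If F_δ vanishes on Λ, then it has all the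
zeros of e_φ, and "F_δ / e_φ is bounded" leaves no room for a series that starts at z^q.

This is made quantitative without infinite products or Weierstrass factorization.
`exists_periods_norm_expCoeff_le` bounds M(ρ) by ρ ∏ ρ/|w| over finitely many nonzero periods w.
Jensen's inequality bounds the first nonzero coefficient c_k of F_δ by its Gauss norm times ∏ |w|/ρ.
The products cancel, leaving |c_k| ρ^(q^k) ≤ Cρ with k ≥ 1, which is impossible for large ρ. Finally
F_δ = 0 forces δ = 0, since α_0 = 1.

Surjectivity is a dimension count (`periodMap_reduced_surjective`). Λ/θΛ embeds in the θ-torsion of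
φ, which has at most q^r points, so Λ is free of rank at most r and Hom_A(Λ, C_∞) has dimension at
most r. The reduced biderivations have dimension at least r. Neither the surjectivity of e_φ nor the
exact rank of Λ is needed beforehand. -/

open Filter Topology

/-! ### Algebraic closedness of complete nonarchimedean fields. -/

/-- A complete nonarchimedean field with a dense algebraically closed subfield is algebraically
closed. -/
theorem isAlgClosed_of_denseRange {K L : Type*} [Field K] [NontriviallyNormedField L]
    [CompleteSpace L] [IsUltrametricDist L] [Algebra K L]
    (hi : DenseRange (algebraMap K L)) [IsAlgClosed K] : IsAlgClosed L := by
  apply IsAlgClosed.of_exists_root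
  intro f fmon firr
  have fnatdeg0 : f.natDegree ≠ 0 := (Irreducible.natDegree_pos firr).ne'
  let E := f.SplittingField
  let : NormedField E := spectralNorm.normedField L E
  let : NormedAlgebra L E := spectralNorm.normedAlgebra L E
  let a : E := Polynomial.rootOfSplits (Polynomial.SplittingField.splits f)
    (by simpa using Polynomial.degree_ne_of_natDegree_ne fnatdeg0)
  have fa0 : f.aeval a = 0 := by
    rw [← Polynomial.eval_map_algebraMap]
    exact Polynomial.eval_rootOfSplits (Polynomial.SplittingField.splits f)
      (by simpa using Polynomial.degree_ne_of_natDegree_ne fnatdeg0)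
  have hclosed : IsClosed (Set.range (algebraMap L E)) :=
    (algebraMap_isometry L E).isClosedEmbedding.isClosed_range
  -- L is complete, hence closed in E, so it is enough to approximate the root a by roots of nearby
  -- polynomials over K, all of which lie in L.
  have ha : a ∈ Set.range (algebraMap L E) := by
    rw [← hclosed.closure_eq, Metric.mem_closure_iff]
    intro δ hδ
    have hε : (δ / (max ‖a‖ 1)) ^ f.natDegree / (f.natDegree + 1) > 0 := by positivity
    obtain ⟨g, gmon, gdeg, gcoeff⟩ :=
      Polynomial.exists_monic_and_natDegree_eq_and_norm_map_algebraMap_coeff_sub_lt hi fmon hε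
    let ⟨b, hb, hab⟩ := Polynomial.exists_aroots_norm_sub_lt_of_norm_coeff_sub_lt
      hε fa0 fmon (gmon.map _) (gdeg ▸ (g.natDegree_map _)) gcoeff
      (by simpa [Polynomial.map_map] using (IsAlgClosed.splits g).map ((algebraMap L E).comp _))
    have hab : ‖a - b‖ < δ := by
      rw [← Real.rpow_natCast, ← mul_comm_div, div_self, one_mul,
        ← Real.rpow_mul (div_pos hδ (by positivity)).le, mul_inv_cancel₀] at hab
      · simpa [mul_assoc, div_mul_cancel₀ _ (by positivity : (max ‖a‖ 1) > 0).ne'] using hab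
      · simp [fnatdeg0]
      · positivity
    rw [Polynomial.aroots_def, Polynomial.Splits.roots_map ((IsAlgClosed.splits g).map _),
        Multiset.mem_map] at hb
    obtain ⟨c, _, rfl⟩ := hb
    exact ⟨_, ⟨c, rfl⟩, by rwa [dist_eq_norm]⟩
  obtain ⟨c, hc⟩ := ha
  refine ⟨c, (algebraMap L E).injective ?_⟩
  rwa [← Polynomial.aeval_algebraMap_apply_eq_algebraMap_eval, hc, map_zero]

/-! ### Gauss norms and Jensen's inequality. -/

lemma IsUltrametricDist.norm_sub_le_max' {L : Type*} [SeminormedAddCommGroup L]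
    [IsUltrametricDist L] (x y : L) : ‖x - y‖ ≤ max ‖x‖ ‖y‖ := by
  simpa [sub_eq_add_neg] using IsUltrametricDist.norm_add_le_max x (-y)

/-- The Gauss norm of a split polynomial is at most the product of those of its factors. -/
lemma norm_coeff_prod_X_sub_C_le {L : Type*} [NormedField L] [IsUltrametricDist L] {ρ : ℝ}
    (hρ : 0 < ρ) (s : Multiset L) (i : ℕ) :
    ‖(s.map fun x => Polynomial.X - Polynomial.C x).prod.coeff i‖ * ρ ^ i
      ≤ (s.map fun x => max ρ ‖x‖).prod := by
  induction s using Multiset.induction generalizing i with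
  | empty =>
    rcases i with _ | i
    · simp
    · simp [Polynomial.coeff_one]
  | cons x s ih =>
    rw [Multiset.map_cons, Multiset.prod_cons, Multiset.map_cons, Multiset.prod_cons, sub_mul]
    have hM : 0 ≤ (s.map fun x => max ρ ‖x‖).prod := (by positivity : (0 : ℝ) ≤ _).trans (ih 0)
    have key : ‖(Polynomial.C x * (s.map fun x => Polynomial.X - Polynomial.C x).prod).coeff i‖
        * ρ ^ i ≤ max ρ ‖x‖ * (s.map fun x => max ρ ‖x‖).prod := by
      rw [Polynomial.coeff_C_mul, norm_mul, mul_assoc]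
      exact mul_le_mul (le_max_right _ _) (ih i) (by positivity) (by positivity)
    rw [Polynomial.coeff_sub]
    refine (mul_le_mul_of_nonneg_right (IsUltrametricDist.norm_sub_le_max' _ _)
      (by positivity)).trans ?_
    rw [max_mul_of_nonneg _ _ (by positivity)]
    refine max_le ?_ key
    rcases i with _ | i
    · rw [Polynomial.coeff_zero_eq_eval_zero]
      simp only [Polynomial.eval_mul, Polynomial.eval_X, zero_mul, norm_zero]
      positivity
    · rw [Polynomial.coeff_X_mul, pow_succ', mul_left_comm]
      exact mul_le_mul (le_max_left _ _) (ih i) (by positivity) (by positivity)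

/-- Jensen's inequality for a power series over a nonarchimedean field. -/
lemma norm_coeff_zero_le_prod {L ι : Type*} [NormedField L] [CompleteSpace L]
    [IsUltrametricDist L] {ρ : ℝ} (hρ : 0 < ρ) (s : Finset ι) (w : ι → L)
    (hinj : Set.InjOn w s) (hw0 : ∀ i ∈ s, w i ≠ 0) (hw : ∀ i ∈ s, ‖w i‖ ≤ ρ)
    (a : ℕ → L) {B : ℝ} (ha : ∀ n, ‖a n‖ * ρ ^ n ≤ B)
    (hlim : Tendsto (fun n => ‖a n‖ * ρ ^ n) atTop (𝓝 0))
    (hzero : ∀ i ∈ s, ∑' n, a n * w i ^ n = 0) :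
    ‖a 0‖ ≤ B * ∏ i ∈ s, (‖w i‖ / ρ) := by
  classical
  induction s using Finset.induction generalizing a B with
  | empty => simpa using ha 0
  | insert i s hi ih =>
    have hsum : ∀ (b : ℕ → L), Tendsto (fun n => ‖b n‖ * ρ ^ n) atTop (𝓝 0) →
        ∀ x : L, ‖x‖ ≤ ρ → Summable fun n => b n * x ^ n := by
      intro b hb x hx
      apply NonarchimedeanAddGroup.summable_of_tendsto_cofinite_zero
      rw [Nat.cofinite_eq_atTop]
      refine squeeze_zero_norm (fun n => ?_) hb
      rw [norm_mul, norm_pow]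
      gcongr
    set x := w i with hx
    have hxρ : ‖x‖ ≤ ρ := hw i (Finset.mem_insert_self _ _)
    have hx0 : x ≠ 0 := hw0 i (Finset.mem_insert_self _ _)
    have hsx := hsum a hlim x hxρ
    have hs : ∀ n, Summable fun j => a (n + j) * x ^ j := by
      intro n
      have := (((summable_nat_add_iff n).2 hsx)).mul_left ((x ^ n)⁻¹)
      refine this.congr fun j => ?_
      rw [pow_add, add_comm j n]
      field_simp
    -- These are the coefficients of the quotient of ∑ a_n T^n by T - x. The induction removes one
    -- zero at a time.
    set h : ℕ → L := fun n => ∑' j, a (n + 1 + j) * x ^ j with hh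
    have hrel : ∀ n, ∑' j, a (n + j) * x ^ j = a n + x * h n := by
      intro n
      rw [(hs n).tsum_eq_zero_add, pow_zero, mul_one, add_zero, hh, ← tsum_mul_left]
      congr 1
      refine tsum_congr fun j => ?_
      rw [show n + 1 + j = n + (j + 1) by ring, pow_succ]
      ring
    have hh0 : a 0 + x * h 0 = 0 := by
      rw [← hrel]
      simpa using hzero i (Finset.mem_insert_self _ _)
    have hhn : ∀ n, h n = a (n + 1) + x * h (n + 1) := fun n => hrel (n + 1)
    have hbound : ∀ n (D : ℝ), (∀ k, n ≤ k → ‖a k‖ * ρ ^ k ≤ D) → ‖h n‖ * ρ ^ n ≤ D / ρ := by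
      intro n D hD
      have hD0 : 0 ≤ D := (by positivity : (0 : ℝ) ≤ _).trans (hD n le_rfl)
      rw [← le_div_iff₀ (by positivity)]
      refine IsUltrametricDist.norm_tsum_le_of_forall_le_of_nonneg (by positivity) fun j => ?_
      rw [le_div_iff₀ (by positivity), le_div_iff₀ (by positivity), norm_mul, norm_pow]
      refine le_trans ?_ (hD (n + 1 + j) (by omega))
      rw [show n + 1 + j = j + n + 1 by ring, pow_succ, pow_add, mul_assoc, mul_assoc, mul_assoc]
      gcongr
    have hhlim : Tendsto (fun n => ‖h n‖ * ρ ^ n) atTop (𝓝 0) := by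
      rw [Metric.tendsto_atTop] at hlim ⊢
      intro ε hε
      obtain ⟨N, hN⟩ := hlim (ε * ρ / 2) (by positivity)
      refine ⟨N, fun n hn => ?_⟩
      have := hbound n (ε * ρ / 2) fun k hk => by
        have := hN k (by omega)
        rw [Real.dist_0_eq_abs, abs_of_nonneg (by positivity)] at this
        exact this.le
      rw [Real.dist_0_eq_abs, abs_of_nonneg (by positivity)]
      refine this.trans_lt ?_
      rw [div_right_comm, mul_div_cancel_right₀ _ hρ.ne']
      linarith
    have hzero' : ∀ k ∈ s, ∑' n, h n * w k ^ n = 0 := by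
      intro k hk
      have hk' : k ∈ insert i s := Finset.mem_insert_of_mem hk
      have hne : w k - x ≠ 0 := by
        rw [sub_ne_zero]
        intro e
        exact hi (hinj hk' (Finset.mem_insert_self _ _) e ▸ hk)
      have h1 := hsum a hlim (w k) (hw k hk')
      have h2 := hsum h hhlim (w k) (hw k hk')
      have h3 := hzero k hk'
      have h4 : ∑' n, a (n + 1) * w k ^ n = ∑' n, h n * w k ^ n
          - x * ∑' n, h (n + 1) * w k ^ n := by
        have h2' : Summable fun n => h (n + 1) * w k ^ n := by
          have := ((summable_nat_add_iff 1).2 h2).mul_left (w k)⁻¹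
          refine this.congr fun j => ?_
          rw [pow_succ]
          have := hw0 k hk'
          field_simp
        rw [← tsum_mul_left, ← h2.tsum_sub (h2'.mul_left x)]
        refine tsum_congr fun n => ?_
        rw [hhn n]; ring
      have h5 : ∑' n, a n * w k ^ n = a 0 + w k * ∑' n, a (n + 1) * w k ^ n := by
        rw [h1.tsum_eq_zero_add, ← tsum_mul_left, pow_zero, mul_one]
        congr 1
        exact tsum_congr fun n => by rw [pow_succ]; ring
      have h6 : ∑' n, h n * w k ^ n = h 0 + w k * ∑' n, h (n + 1) * w k ^ n := by
        rw [h2.tsum_eq_zero_add, ← tsum_mul_left, pow_zero, mul_one]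
        congr 1
        exact tsum_congr fun n => by rw [pow_succ]; ring
      have h7 : (w k - x) * ∑' n, h n * w k ^ n = 0 := by
        linear_combination h3 - h5 - w k * h4 - x * h6 - hh0
      exact (mul_eq_zero.1 h7).resolve_left hne
    -- Dividing by T - x lowers the Gauss bound from B to B/ρ, and a_0 = -x h_0 contributes ‖x‖;
    -- together they give the factor ‖x‖/ρ.
    have := ih (hinj.mono (by simp)) (fun k hk => hw0 k (Finset.mem_insert_of_mem hk))
      (fun k hk => hw k (Finset.mem_insert_of_mem hk)) h (B := B / ρ)
      (fun n => hbound n B fun k _ => ha k) hhlim hzero'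
    rw [Finset.prod_insert hi, eq_neg_of_add_eq_zero_left hh0, norm_neg, norm_mul]
    calc _ ≤ ‖x‖ * (B / ρ * ∏ i ∈ s, (‖w i‖ / ρ)) := by gcongr
      _ = _ := by ring

namespace DrinfeldDeRham
variable {F : Type*} [Field F] [Fintype F]

noncomputable instance : Algebra (KInftyAlgCl F) (CInfty F) :=
  inferInstanceAs (Algebra (KInftyAlgCl F) (UniformSpace.Completion (KInftyAlgCl F)))

instance : IsAlgClosed (CInfty F) := by
  have : IsAlgClosed (KInftyAlgCl F) := IsAlgClosure.isAlgClosed (KInfty F)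
  exact isAlgClosed_of_denseRange (K := KInftyAlgCl F)
    (UniformSpace.Completion.denseRange_coe (α := KInftyAlgCl F))

end DrinfeldDeRham

/-! ### Roots of F_q-linear polynomials. -/

namespace DrinfeldDeRham
open scoped Polynomial
open Filter Topology

variable {F : Type*} [Field F] [Fintype F]

lemma card_eq_zero_CInfty : ((Fintype.card F : ℕ) : CInfty F) = 0 := by
  have := congrArg (algebraMap F (CInfty F)) (FiniteField.cast_card_eq_zero F)
  rwa [map_natCast, map_zero] at this

/-- The polynomial `∑ c_n X ^ (q ^ n)` attached to the twisted polynomial `∑ c_n τ ^ n`. -/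
noncomputable def twPoly (f : TwistedPolynomial F) : (CInfty F)[X] :=
  SkewPolynomial.sum f fun n c => Polynomial.monomial (Fintype.card F ^ n) c

lemma eval_twPoly (f : TwistedPolynomial F) (x : CInfty F) :
    (twPoly f).eval x = twEval f x := by
  simp only [twPoly, twEval, SkewPolynomial.sum_def, Polynomial.eval_finsetSum,
    Polynomial.eval_monomial]

lemma coeff_twPoly_pow (f : TwistedPolynomial F) (j : ℕ) :
    (twPoly f).coeff (Fintype.card F ^ j) = SkewPolynomial.coeff f j := by
  have hinj : Function.Injective fun n : ℕ => Fintype.card F ^ n :=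
    Nat.pow_right_injective Fintype.one_lt_card
  simp only [twPoly, SkewPolynomial.sum_def, Polynomial.finsetSum_coeff,
    Polynomial.coeff_monomial, hinj.eq_iff, Finset.sum_ite_eq', SkewPolynomial.mem_support_iff]
  split_ifs with h
  · rfl
  · exact (SkewPolynomial.notMem_support_iff.1 h).symm

lemma coeff_twPoly_zero (f : TwistedPolynomial F) : (twPoly f).coeff 0 = 0 := by
  simp only [twPoly, SkewPolynomial.sum_def, Polynomial.finsetSum_coeff,
    Polynomial.coeff_monomial]
  refine Finset.sum_eq_zero fun n _ => if_neg (pow_pos Fintype.card_pos n).ne'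

/-- Since q = 0 in C_∞, only the linear term survives differentiation. A nonzero constant term of f
therefore makes `twPoly f` separable. -/
lemma derivative_twPoly (f : TwistedPolynomial F) :
    Polynomial.derivative (twPoly f) = Polynomial.C (SkewPolynomial.coeff f 0) := by
  ext i
  rw [Polynomial.coeff_derivative]
  by_cases hi : i = 0
  · subst hi
    have := coeff_twPoly_pow f 0
    rw [pow_zero] at this
    simp [this]
  rw [Polynomial.coeff_C, if_neg hi]
  simp only [twPoly, SkewPolynomial.sum_def, Polynomial.finsetSum_coeff,
    Polynomial.coeff_monomial, Finset.sum_mul]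
  refine Finset.sum_eq_zero fun n _ => ?_
  split_ifs with h
  · have hn : n ≠ 0 := by rintro rfl; simp at h; omega
    have : ((i : CInfty F) + 1) = 0 := by
      rw [← Nat.cast_succ, Nat.succ_eq_add_one, ← h, Nat.cast_pow, card_eq_zero_CInfty,
        zero_pow hn]
    rw [this, mul_zero]
  · exact zero_mul _

lemma twPoly_ne_zero {f : TwistedPolynomial F} (hf : SkewPolynomial.coeff f 0 ≠ 0) :
    twPoly f ≠ 0 := by
  intro h
  have := coeff_twPoly_pow f 0
  rw [h, Polynomial.coeff_zero] at this
  exact hf this.symm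

lemma natDegree_twPoly_le {f : TwistedPolynomial F} {r : ℕ}
    (hf : ∀ n, r < n → SkewPolynomial.coeff f n = 0) :
    (twPoly f).natDegree ≤ Fintype.card F ^ r := by
  rw [twPoly, SkewPolynomial.sum_def]
  refine Polynomial.natDegree_sum_le_of_forall_le _ _ fun n hn => ?_
  refine (Polynomial.natDegree_monomial_le _).trans (Nat.pow_le_pow_right Fintype.card_pos ?_)
  by_contra h
  exact SkewPolynomial.mem_support_iff.1 hn (hf n (by omega))

open Classical in
/-- The nonzero roots of norm at most `ρ` of `∑ c_n X ^ (q ^ n)`. -/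
noncomputable def smallRoots (f : TwistedPolynomial F) (ρ : ℝ) : Finset (CInfty F) :=
  (twPoly f).roots.toFinset.filter fun x => x ≠ 0 ∧ ‖x‖ ≤ ρ

/-- Split the polynomial as its leading coefficient times X ∏ (X - x), with distinct nonzero roots
x. In the Gauss norm of radius ρ each factor contributes max(ρ, ‖x‖), while the coefficient of X
contributes ‖x‖. In the ratio the roots outside the disc cancel, and each root inside it leaves
ρ/‖x‖. -/
lemma norm_coeff_mul_pow_le_prod {f : TwistedPolynomial F}
    (hf : SkewPolynomial.coeff f 0 ≠ 0) {ρ : ℝ} (hρ : 0 < ρ) (j : ℕ) :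
    ‖SkewPolynomial.coeff f j‖ * ρ ^ Fintype.card F ^ j
      ≤ ‖SkewPolynomial.coeff f 0‖ * ρ * ∏ x ∈ smallRoots f ρ, (ρ / ‖x‖) := by
  classical
  set p := twPoly f with hp
  have hp0 : p ≠ 0 := twPoly_ne_zero hf
  have hnodup : p.roots.Nodup := by
    refine Polynomial.nodup_roots ?_
    rw [Polynomial.separable_def, hp, derivative_twPoly]
    exact ⟨0, Polynomial.C (SkewPolynomial.coeff f 0)⁻¹, by
      rw [zero_mul, zero_add, ← map_mul, inv_mul_cancel₀ hf, map_one]⟩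
  have h0 : (0 : CInfty F) ∈ p.roots := by
    rw [Polynomial.mem_roots hp0, Polynomial.IsRoot, ← Polynomial.coeff_zero_eq_eval_zero,
      coeff_twPoly_zero]
  obtain ⟨R, hR⟩ := Multiset.exists_cons_of_mem h0
  have hsplit : p = Polynomial.C p.leadingCoeff *
      (Polynomial.X * (R.map fun x => Polynomial.X - Polynomial.C x).prod) := by
    have := (IsAlgClosed.splits p).eq_prod_roots
    rw [hR] at this
    simpa using this
  have hnd : R.Nodup := by rw [hR] at hnodup; exact (Multiset.nodup_cons.1 hnodup).2
  have hR0 : (0 : CInfty F) ∉ R := by rw [hR] at hnodup; exact (Multiset.nodup_cons.1 hnodup).1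
  have hcoeff0 : ‖SkewPolynomial.coeff f 0‖ = ‖p.leadingCoeff‖ * (R.map fun x => ‖x‖).prod := by
    have h1 : SkewPolynomial.coeff f 0 = p.coeff 1 := by
      rw [← coeff_twPoly_pow f 0, pow_zero]
    rw [h1, hsplit, Polynomial.coeff_C_mul, ← zero_add 1, Polynomial.coeff_X_mul,
      Polynomial.coeff_zero_eq_eval_zero, Polynomial.eval_multiset_prod, norm_mul, ← hsplit]
    congr 1
    rw [Multiset.map_map]
    have h2 := map_multiset_prod (normHom : CInfty F →*₀ ℝ) (R.map fun x => -x)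
    simpa [Function.comp_def] using h2
  have hj : ‖SkewPolynomial.coeff f j‖ * ρ ^ Fintype.card F ^ j
      ≤ ‖p.leadingCoeff‖ * (ρ * (R.map fun x => max ρ ‖x‖).prod) := by
    have h1 := norm_coeff_prod_X_sub_C_le hρ (0 ::ₘ R) (Fintype.card F ^ j)
    rw [Multiset.map_cons, Multiset.map_cons, Multiset.prod_cons, Multiset.prod_cons, norm_zero,
      max_eq_left hρ.le, map_zero, sub_zero] at h1
    rw [← coeff_twPoly_pow f j, ← hp, hsplit, Polynomial.coeff_C_mul, norm_mul, mul_assoc,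
      ← hsplit]
    gcongr
  have hRfin : ∀ g : CInfty F → ℝ, (R.map g).prod = ∏ x ∈ R.toFinset, g x := by
    intro g
    rw [Finset.prod, Multiset.toFinset_val, Multiset.dedup_eq_self.2 hnd]
  have hS : smallRoots f ρ = R.toFinset.filter fun x => ‖x‖ ≤ ρ := by
    ext x
    simp only [smallRoots, ← hp, hR, Finset.mem_filter, Multiset.mem_toFinset,
      Multiset.mem_cons]
    constructor
    · rintro ⟨h | h, h1, h2⟩
      · exact absurd h h1
      · exact ⟨h, h2⟩
    · rintro ⟨h, h2⟩
      exact ⟨Or.inr h, fun e => hR0 (e ▸ h), h2⟩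
  refine hj.trans (le_of_eq ?_)
  rw [hcoeff0, hRfin, hRfin, hS, Finset.prod_filter]
  have : ∏ x ∈ R.toFinset, max ρ ‖x‖
      = (∏ x ∈ R.toFinset, ‖x‖) * ∏ x ∈ R.toFinset, if ‖x‖ ≤ ρ then ρ / ‖x‖ else 1 := by
    rw [← Finset.prod_mul_distrib]
    refine Finset.prod_congr rfl fun x hx => ?_
    have hx0 : ‖x‖ ≠ 0 := by
      rw [norm_ne_zero_iff]
      rintro rfl
      exact hR0 (Multiset.mem_toFinset.1 hx)
    split_ifs with h
    · rw [max_eq_left h, mul_div_cancel₀ _ hx0]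
    · rw [max_eq_right (le_of_not_ge h), mul_one]
  rw [this]
  ring

/-! ### The exponential near zero, and periods in large discs. -/

namespace DrinfeldModule

variable {r : ℕ} (φ : DrinfeldModule F r)

/-- Take ε = 1/(2B), where B ≥ 1 bounds all ‖α_n‖. For n ≥ 1 the exponent q^n is at least 2, so for
t ≤ ε the n-th term is at most B t² ≤ t/2. Thus the linear term dominates on this disc. -/
lemma exists_isometry_radius : ∃ ε : ℝ, 0 < ε ∧
    (∀ n, ‖φ.expCoeff n‖ * ε ^ Fintype.card F ^ n ≤ ε) ∧
    ∀ z : CInfty F, ‖z‖ ≤ ε → ‖φ.exp z - z‖ ≤ ‖z‖ / 2 := by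
  have hq2 : 2 ≤ Fintype.card F := Fintype.one_lt_card
  obtain ⟨B₀, hB₀⟩ := (φ.expCoeff_mem 1).bddAbove_range
  set B := max B₀ 1
  have hB : ∀ n, ‖φ.expCoeff n‖ ≤ B := fun n => by
    have := hB₀ (Set.mem_range_self n)
    simp only [one_pow, mul_one] at this
    exact this.trans (le_max_left _ _)
  have hB1 : 1 ≤ B := le_max_right _ _
  have key : ∀ t : ℝ, 0 ≤ t → t ≤ (2 * B)⁻¹ → ∀ n,
      ‖φ.expCoeff (n + 1)‖ * t ^ Fintype.card F ^ (n + 1) ≤ t / 2 := by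
    intro t ht htB n
    have ht1 : t ≤ 1 := htB.trans (inv_le_one_of_one_le₀ (by linarith))
    have h2 : 2 ≤ Fintype.card F ^ (n + 1) := hq2.trans (Nat.le_self_pow (by omega) _)
    calc _ ≤ B * t ^ 2 := by
          gcongr ?_ * ?_
          · exact hB _
          · exact pow_le_pow_of_le_one ht ht1 h2
      _ = B * t * t := by ring
      _ ≤ B * (2 * B)⁻¹ * t := by gcongr
      _ = t / 2 := by field_simp
  refine ⟨(2 * B)⁻¹, by positivity, fun n => ?_, fun z hz => ?_⟩
  · cases n with
    | zero => simp [expCoeff]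
    | succ n =>
      exact (key _ (by positivity) le_rfl n).trans (half_le_self (by positivity))
  · rw [exp, (entireSeq_summable φ.expCoeff_mem z).tsum_eq_zero_add]
    rw [show φ.expCoeff 0 = 1 by rw [expCoeff], pow_zero, pow_one, one_mul, add_sub_cancel_left]
    refine IsUltrametricDist.norm_tsum_le_of_forall_le_of_nonneg (by positivity) fun n => ?_
    rw [norm_mul, norm_pow]
    exact key _ (norm_nonneg _) hz n

variable {φ} in
lemma norm_exp_of_le {ε : ℝ}
    (hiso : ∀ z : CInfty F, ‖z‖ ≤ ε → ‖φ.exp z - z‖ ≤ ‖z‖ / 2) {z : CInfty F} (hz : ‖z‖ ≤ ε) : ‖φ.exp z‖ = ‖z‖ := by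
  rcases eq_or_ne z 0 with rfl | h
  · simpa using hiso 0 hz
  · have h1 := hiso z hz
    have h2 : 0 < ‖z‖ := norm_pos_iff.2 h
    have h3 : ‖z + (φ.exp z - z)‖ = max ‖z‖ ‖φ.exp z - z‖ :=
      IsUltrametricDist.norm_add_eq_max_of_norm_ne_norm (by linarith)
    rw [add_sub_cancel, max_eq_left (by linarith)] at h3
    exact h3

-- This is a local logarithm, obtained as a Neumann series: g = id - e_φ is additive and halves
-- norms on the disc, so z = ∑ g^n(x) solves e_φ(z) = x.
variable {φ} in
lemma exists_exp_eq_of_le {ε : ℝ}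
    (hiso : ∀ z : CInfty F, ‖z‖ ≤ ε → ‖φ.exp z - z‖ ≤ ‖z‖ / 2) (hε : 0 < ε) {x : CInfty F} (hx : ‖x‖ ≤ ε) :
    ∃ z, ‖z‖ = ‖x‖ ∧ φ.exp z = x := by
  let E : CInfty F →+ CInfty F := AddMonoidHom.mk' φ.exp φ.exp_add
  have hE : Continuous E := by
    refine continuous_of_continuousAt_zero E ?_
    rw [ContinuousAt, map_zero, tendsto_zero_iff_norm_tendsto_zero]
    have h1 : Tendsto (fun z : CInfty F => ‖z‖) (𝓝 0) (𝓝 0) := by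
      simpa using (continuous_norm (E := CInfty F)).tendsto 0
    refine h1.congr' ?_
    filter_upwards [h1.eventually_le_const hε] with z hz
    exact (norm_exp_of_le hiso hz).symm
  let g : CInfty F →+ CInfty F := AddMonoidHom.id _ - E
  have hg : ∀ z, ‖z‖ ≤ ε → ‖g z‖ ≤ ‖z‖ / 2 := fun z hz => by
    change ‖z - φ.exp z‖ ≤ _
    rw [norm_sub_rev]
    exact hiso z hz
  have hit : ∀ n, ‖g^[n] x‖ ≤ ‖x‖ * (1 / 2) ^ n := by
    intro n
    induction n with
    | zero => simp
    | succ n ih =>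
      rw [Function.iterate_succ_apply', pow_succ]
      have h1 : ‖g^[n] x‖ ≤ ε := by
        refine (ih.trans ?_).trans hx
        exact mul_le_of_le_one_right (norm_nonneg _) (pow_le_one₀ (by norm_num) (by norm_num))
      linarith [hg _ h1]
  have hs : Summable fun n => g^[n] x :=
    Summable.of_norm_bounded
      ((summable_geometric_of_lt_one (by norm_num) (by norm_num)).mul_left _) hit
  set z := ∑' n, g^[n] x with hz
  have hexp : φ.exp z = x := by
    change E z = x
    rw [hz, hs.map_tsum E hE]
    have h1 : ∀ n, E (g^[n] x) = g^[n] x - g^[n + 1] x := fun n => by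
      rw [Function.iterate_succ_apply']
      exact (sub_sub_cancel _ _).symm
    simp_rw [h1]
    rw [hs.tsum_sub ((summable_nat_add_iff 1).2 hs), hs.tsum_eq_zero_add]
    simp
  have hzε : ‖z‖ ≤ ‖x‖ :=
    IsUltrametricDist.norm_tsum_le_of_forall_le_of_nonneg (norm_nonneg _) fun n =>
      (hit n).trans (mul_le_of_le_one_right (norm_nonneg _)
        (pow_le_one₀ (by norm_num) (by norm_num)))
  exact ⟨z, by rw [← norm_exp_of_le hiso (hzε.trans hx), hexp], hexp⟩

lemma exp_θ_pow_mul (n : ℕ) (z : CInfty F) :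
    φ.exp (θ F ^ n * z) = twEval (φ.toAlgHom (Polynomial.X ^ n)) (φ.exp z) := by
  rw [← exp_algebraMap_mul, Algebra.smul_def, map_pow]
  rfl

/-- The coefficientwise form of e_φ(θ^n z) = φ_{θ^n}(e_φ(z)), needed because Gauss norms are read
off coefficients. -/
lemma twAct_X_pow_expSeq (n k : ℕ) :
    (twAct (shiftHom F) (φ.toAlgHom (Polynomial.X ^ n)) φ.expSeq).1 k
      = (θ F ^ n) ^ Fintype.card F ^ k * φ.expCoeff k := by
  induction n generalizing k with
  | zero =>
    rw [pow_zero, map_one, ← SkewPolynomial.monomial_zero_one, twAct_monomial]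
    simp [expSeq]
  | succ n ih =>
    rw [pow_succ, map_mul, twAct_mul _ shiftHom_smul, twAct_shift_apply]
    have h1 := ih k
    rw [twAct_shift_apply] at h1
    rw [pow_succ, mul_pow, mul_right_comm, ← h1, Finset.sum_mul]
    refine Finset.sum_congr rfl fun j hj => ?_
    rw [twAct_expSeq, mul_pow, ← pow_mul, ← pow_add,
      Nat.sub_add_cancel (Nat.lt_succ_iff.1 (Finset.mem_range.1 hj)), mul_left_comm]
    exact mul_comm _ _

lemma coeff_X_pow_zero (n : ℕ) :
    SkewPolynomial.coeff (φ.toAlgHom (Polynomial.X ^ n)) 0 = θ F ^ n := by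
  rw [φ.coeff_zero, map_pow]
  rfl

lemma θ_ne_zero : θ F ≠ 0 := by
  rw [← norm_ne_zero_iff, norm_θ]
  exact_mod_cast Fintype.card_ne_zero

/-- The Gauss norm of the exponential function on the disc of radius `ρ = q ^ n ε` is bounded in
terms of periods in this disc. -/
lemma exists_periods_norm_expCoeff_le {ε : ℝ} (hε : 0 < ε)
    (hcoeff : ∀ n, ‖φ.expCoeff n‖ * ε ^ Fintype.card F ^ n ≤ ε)
    (hiso : ∀ z : CInfty F, ‖z‖ ≤ ε → ‖φ.exp z - z‖ ≤ ‖z‖ / 2) (n : ℕ) {ρ : ℝ}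
    (hρ : ρ = (Fintype.card F : ℝ) ^ n * ε) :
    ∃ W : Finset (CInfty F),
      (∀ w ∈ W, w ∈ φ.periodLattice ∧ w ≠ 0 ∧ ‖w‖ ≤ ρ) ∧
      ∀ k, ‖φ.expCoeff k‖ * ρ ^ Fintype.card F ^ k ≤ ρ * ∏ w ∈ W, (ρ / ‖w‖) := by
  classical
  have hq : (0 : ℝ) < Fintype.card F := by exact_mod_cast Fintype.card_pos
  have hρ0 : 0 < ρ := by rw [hρ]; positivity
  set f := φ.toAlgHom (Polynomial.X ^ n) with hf
  have hf0 : SkewPolynomial.coeff f 0 = θ F ^ n := φ.coeff_X_pow_zero n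
  have hf0' : SkewPolynomial.coeff f 0 ≠ 0 := by
    rw [hf0]; exact pow_ne_zero _ θ_ne_zero
  have hlog : ∀ x : CInfty F, ∃ z : CInfty F, ‖x‖ ≤ ε → ‖z‖ = ‖x‖ ∧ φ.exp z = x := by
    intro x
    by_cases hx : ‖x‖ ≤ ε
    · obtain ⟨z, hz⟩ := exists_exp_eq_of_le hiso hε hx
      exact ⟨z, fun _ => hz⟩
    · exact ⟨0, fun h => absurd h hx⟩
  -- l is the local logarithm, with the junk value 0 outside the disc of radius ε.
  choose l hl using hlog
  have hmem : ∀ x ∈ smallRoots f ε, twEval f x = 0 ∧ x ≠ 0 ∧ ‖x‖ ≤ ε := by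
    intro x hx
    rw [smallRoots, Finset.mem_filter, Multiset.mem_toFinset,
      Polynomial.mem_roots (twPoly_ne_zero hf0'), Polynomial.IsRoot, eval_twPoly] at hx
    exact hx
  have hnorm : ∀ x ∈ smallRoots f ε, ‖θ F ^ n * l x‖ = (Fintype.card F : ℝ) ^ n * ‖x‖ := by
    intro x hx
    rw [norm_mul, norm_pow, norm_θ, (hl x (hmem x hx).2.2).1]
  -- A root x of φ_{θ^n} with ‖x‖ ≤ ε gives the period θ^n l(x), because e_φ(θ^n l(x)) = φ_{θ^n}(x)
  -- = 0. Its norm is q^n ‖x‖, so the ratios ρ/‖w‖ and ε/‖x‖ agree.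
  refine ⟨(smallRoots f ε).image fun x => θ F ^ n * l x, ?_, fun k => ?_⟩
  · intro w hw
    obtain ⟨x, hx, rfl⟩ := Finset.mem_image.1 hw
    obtain ⟨h1, h2, h3⟩ := hmem x hx
    refine ⟨?_, ?_, ?_⟩
    · rw [mem_periodLattice, exp_θ_pow_mul, (hl x h3).2, h1]
    · rw [← norm_ne_zero_iff, hnorm x hx]
      have := norm_pos_iff.2 h2
      positivity
    · rw [hnorm x hx, hρ]
      gcongr
  · rw [Finset.prod_image]
    swap
    · intro x hx y hy hxy
      have h1 : l x = l y := mul_left_cancel₀ (pow_ne_zero n θ_ne_zero) hxy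
      rw [← (hl x (hmem x hx).2.2).2, h1, (hl y (hmem y hy).2.2).2]
    have hprod : ∏ x ∈ smallRoots f ε, (ρ / ‖θ F ^ n * l x‖)
        = ∏ x ∈ smallRoots f ε, (ε / ‖x‖) := by
      refine Finset.prod_congr rfl fun x hx => ?_
      rw [hnorm x hx, hρ, mul_div_mul_left _ _ (by positivity)]
    -- Rescaling by θ^n replaces e_φ at radius ρ by φ_{θ^n} ∘ e_φ at radius ε. There e_φ has Gauss
    -- norm at most ε, so only the Gauss norm of the polynomial φ_{θ^n} at radius ε remains to be
    -- bounded.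
    have hk : ‖φ.expCoeff k‖ * ρ ^ Fintype.card F ^ k
        = ‖(twAct (shiftHom F) f φ.expSeq).1 k‖ * ε ^ Fintype.card F ^ k := by
      rw [twAct_X_pow_expSeq, norm_mul, norm_pow, norm_pow, norm_θ, hρ, mul_pow]
      ring
    rw [hprod, hk, twAct_shift_apply, ← le_div_iff₀ (by positivity)]
    refine IsUltrametricDist.norm_sum_le_of_forall_le_of_nonneg (by positivity) fun j hj => ?_
    rw [le_div_iff₀ (by positivity), norm_mul, norm_pow]
    have hjk : j ≤ k := Nat.lt_succ_iff.1 (Finset.mem_range.1 hj)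
    calc _ = ‖SkewPolynomial.coeff f j‖ *
          (‖φ.expCoeff (k - j)‖ * ε ^ Fintype.card F ^ (k - j)) ^ Fintype.card F ^ j := by
          rw [mul_pow, ← pow_mul ε, ← pow_add, Nat.sub_add_cancel hjk, ← mul_assoc]
          rfl
      _ ≤ ‖SkewPolynomial.coeff f j‖ * ε ^ Fintype.card F ^ j := by
          gcongr
          exact hcoeff _
      _ ≤ _ := norm_coeff_mul_pow_le_prod hf0' hε j
      _ = _ := by rw [hf0, norm_pow, norm_θ, hρ]

end DrinfeldModule
end DrinfeldDeRham

/-! ### Growth of F_δ and injectivity on reduced biderivations. -/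

namespace DrinfeldDeRham
open scoped Polynomial
open Filter Topology

variable {F : Type*} [Field F] [Fintype F]

lemma exists_norm_coeff_le (f : TwistedPolynomial F) :
    ∃ G : ℝ, 0 ≤ G ∧ ∀ j, ‖SkewPolynomial.coeff f j‖ ≤ G := by
  refine ⟨∑ j ∈ f.support, ‖SkewPolynomial.coeff f j‖,
    Finset.sum_nonneg fun _ _ => norm_nonneg _, fun j => ?_⟩
  by_cases hj : j ∈ f.support
  · exact Finset.single_le_sum (f := fun j => ‖SkewPolynomial.coeff f j‖)
      (fun _ _ => norm_nonneg _) hj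
  · rw [SkewPolynomial.notMem_support_iff.1 hj, norm_zero]
    exact Finset.sum_nonneg fun _ _ => norm_nonneg _

/-- Jensen's inequality for `F_q`-linear entire functions. -/
lemma norm_coeff_le_prod_of_seriesEval_eq_zero (s : entireSeq F) (k : ℕ)
    (hk : ∀ n < k, s.1 n = 0) {ρ B : ℝ} (hρ : 0 < ρ)
    (hB : ∀ n, ‖s.1 n‖ * ρ ^ Fintype.card F ^ n ≤ B) (W : Finset (CInfty F))
    (hW : ∀ w ∈ W, w ≠ 0 ∧ ‖w‖ ≤ ρ ∧ seriesEval w s = 0) :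
    ‖s.1 k‖ * ρ ^ Fintype.card F ^ k ≤ B * ∏ w ∈ W, (‖w‖ / ρ) := by
  set q := Fintype.card F with hq
  have hq1 : 1 < q := Fintype.one_lt_card
  -- The sequence a built from e is that of the power series s(z)/z^(q^k): the exponents q^(k+n) -
  -- q^k carry s_(k+n), and the other coefficients are 0. Its constant term is s_k.
  let e : ℕ → ℕ := fun n => q ^ (k + n) - q ^ k
  have hqk : ∀ n, q ^ k ≤ q ^ (k + n) := fun n => Nat.pow_le_pow_right (by omega) (by omega)
  have he : StrictMono e := by
    refine strictMono_nat_of_lt_succ fun n => ?_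
    have h1 : q ^ (k + n) < q ^ (k + (n + 1)) := Nat.pow_lt_pow_right hq1 (by omega)
    have := hqk n
    change q ^ (k + n) - q ^ k < q ^ (k + (n + 1)) - q ^ k
    omega
  have he' : ∀ n, e n + q ^ k = q ^ (k + n) := fun n => Nat.sub_add_cancel (hqk n)
  let a : ℕ → CInfty F := Function.extend e (fun n => s.1 (k + n)) 0
  have ha : ∀ n, a (e n) = s.1 (k + n) := fun n => he.injective.extend_apply _ _ _
  have ha' : ∀ j, j ∉ Set.range e → a j = 0 := fun j hj =>
    Function.extend_apply' _ _ _ hj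
  have hB0 : 0 ≤ B := (by positivity : (0 : ℝ) ≤ _).trans (hB 0)
  have hterm : ∀ n, ‖a (e n)‖ * ρ ^ e n
      = ‖s.1 (k + n)‖ * ρ ^ q ^ (k + n) / ρ ^ q ^ k := fun n => by
    rw [ha, ← he', pow_add]
    field_simp
  have hbound : ∀ j, ‖a j‖ * ρ ^ j ≤ B / ρ ^ q ^ k := by
    intro j
    by_cases hj : j ∈ Set.range e
    · obtain ⟨n, rfl⟩ := hj
      rw [hterm]
      gcongr
      exact hB _
    · rw [ha' j hj, norm_zero, zero_mul]
      positivity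
  have hlim : Tendsto (fun j => ‖a j‖ * ρ ^ j) atTop (𝓝 0) := by
    have h1 : Tendsto (fun n => ‖a (e n)‖ * ρ ^ e n) atTop (𝓝 0) := by
      simp_rw [hterm]
      have h2 := ((tendsto_add_atTop_iff_nat k).2 (s.2 ρ)).div_const (ρ ^ q ^ k)
      rw [zero_div] at h2
      refine h2.congr fun n => ?_
      rw [add_comm n k]
    rw [Metric.tendsto_atTop] at h1 ⊢
    intro ε hε
    obtain ⟨N, hN⟩ := h1 ε hε
    refine ⟨e N, fun j hj => ?_⟩
    by_cases hj' : j ∈ Set.range e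
    · obtain ⟨n, rfl⟩ := hj'
      exact hN n (he.le_iff_le.1 hj)
    · rw [ha' j hj', norm_zero, zero_mul, dist_self]
      exact hε
  have hzero : ∀ w ∈ W, ∑' j, a j * w ^ j = 0 := by
    intro w hw
    obtain ⟨hw0, -, hw1⟩ := hW w hw
    have h1 : ∑' n, a (e n) * w ^ e n = ∑' j, a j * w ^ j := by
      refine he.injective.tsum_eq (f := fun j => a j * w ^ j) fun j hj => ?_
      by_contra h
      exact hj (by simp only [ha' j h, zero_mul])
    rw [← h1]
    have h2 : ∑' n, s.1 n * w ^ q ^ n = 0 := hw1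
    rw [← (entireSeq_summable s.2 w).sum_add_tsum_nat_add k,
      Finset.sum_eq_zero fun n hn => by rw [hk n (Finset.mem_range.1 hn), zero_mul],
      zero_add] at h2
    have h3 : ∑' n, s.1 (n + k) * w ^ q ^ (n + k) = w ^ q ^ k * ∑' n, a (e n) * w ^ e n := by
      rw [← tsum_mul_left]
      refine tsum_congr fun n => ?_
      rw [ha, add_comm n k, ← he', pow_add]
      ring
    exact (mul_eq_zero.1 (h3.symm.trans h2)).resolve_left (pow_ne_zero _ hw0)
  have := norm_coeff_zero_le_prod hρ W id (Set.injOn_id _) (fun w hw => (hW w hw).1)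
    (fun w hw => (hW w hw).2.1) a hbound hlim hzero
  have h0 : a 0 = s.1 k := by
    have := ha 0
    rwa [show e 0 = 0 from Nat.sub_self _, add_zero] at this
  rw [h0] at this
  rw [← le_div_iff₀ (by positivity)]
  refine this.trans (le_of_eq ?_)
  simp only [id]
  ring

/-- The Gauss norm is attained: the terms tend to 0, so only finitely many reach the positive value
of the term of index 0. -/
lemma exists_forall_norm_coeff_le (s : entireSeq F) {ρ : ℝ} (hρ : 0 < ρ) (h0 : s.1 0 ≠ 0) :
    ∃ k, ∀ n, ‖s.1 n‖ * ρ ^ Fintype.card F ^ n ≤ ‖s.1 k‖ * ρ ^ Fintype.card F ^ k := by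
  set b : ℕ → ℝ := fun n => ‖s.1 n‖ * ρ ^ Fintype.card F ^ n
  have hb0 : 0 < b 0 := mul_pos (norm_pos_iff.2 h0) (by positivity)
  have hfin : {n | b 0 ≤ b n}.Finite := by
    have := (s.2 ρ).eventually_lt_const hb0
    rw [← Nat.cofinite_eq_atTop, Filter.eventually_cofinite] at this
    simpa [b] using this
  obtain ⟨k, hk, hmax⟩ := Set.exists_max_image _ b hfin ⟨0, le_refl (b 0)⟩
  refine ⟨k, fun n => ?_⟩
  by_cases hn : b 0 ≤ b n
  · exact hmax n hn
  · exact (le_of_not_ge hn).trans hk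

namespace DrinfeldModule

variable {r : ℕ} (φ : DrinfeldModule F r)

/-- Composing e_φ with c τ^j raises its Gauss norm to the power q^j. As M ≥ 1, the worst case among
j ≤ r is j = r. -/
lemma norm_twAct_expSeq_le (d : TwistedPolynomial F) (hd : ∀ j, r < j → SkewPolynomial.coeff d j = 0)
    {D M ρ : ℝ} (hρ : 0 < ρ) (hM : 1 ≤ M) (hD : ∀ j, ‖SkewPolynomial.coeff d j‖ ≤ D)
    (hα : ∀ n, ‖φ.expCoeff n‖ * ρ ^ Fintype.card F ^ n ≤ M) (n : ℕ) :
    ‖(twAct (shiftHom F) d φ.expSeq).1 n‖ * ρ ^ Fintype.card F ^ n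
      ≤ D * M ^ Fintype.card F ^ r := by
  have hD0 : 0 ≤ D := (norm_nonneg _).trans (hD 0)
  rw [twAct_shift_apply, ← le_div_iff₀ (by positivity)]
  refine IsUltrametricDist.norm_sum_le_of_forall_le_of_nonneg (by positivity) fun j hj => ?_
  rw [le_div_iff₀ (by positivity), norm_mul, norm_pow]
  have hjn : j ≤ n := Nat.lt_succ_iff.1 (Finset.mem_range.1 hj)
  by_cases hjr : r < j
  · rw [hd j hjr, norm_zero, zero_mul, zero_mul]
    positivity
  calc _ = ‖SkewPolynomial.coeff d j‖ *
        (‖φ.expCoeff (n - j)‖ * ρ ^ Fintype.card F ^ (n - j)) ^ Fintype.card F ^ j := by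
        rw [mul_pow, ← pow_mul ρ, ← pow_add, Nat.sub_add_cancel hjn, ← mul_assoc]
        rfl
    _ ≤ D * M ^ Fintype.card F ^ j := by
        gcongr
        · exact hD j
        · exact hα _
    _ ≤ D * M ^ Fintype.card F ^ r := by
        gcongr
        · exact Fintype.card_pos
        · omega

/-- For large `ρ` the Gauss norm of `e_φ(θ z)` is that of the leading term of `φ_θ(e_φ(z))`. -/
lemma exists_norm_expCoeff_ge : ∃ ρ₀ : ℝ, 1 ≤ ρ₀ ∧ ∀ ρ, ρ₀ ≤ ρ → ∀ k,
    (∀ n, ‖φ.expCoeff n‖ * ρ ^ Fintype.card F ^ n ≤ ‖φ.expCoeff k‖ * ρ ^ Fintype.card F ^ k) →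
    ‖SkewPolynomial.coeff (φ.toAlgHom Polynomial.X) r‖ *
        (‖φ.expCoeff k‖ * ρ ^ Fintype.card F ^ k) ^ Fintype.card F ^ r
      ≤ ‖φ.expCoeff (k + r)‖ * (Fintype.card F * ρ) ^ Fintype.card F ^ (k + r) := by
  obtain ⟨G, hG0, hG⟩ := exists_norm_coeff_le (φ.toAlgHom Polynomial.X)
  set g := SkewPolynomial.coeff (φ.toAlgHom Polynomial.X) with hg
  have hgr : 0 < ‖g r‖ := norm_pos_iff.2 φ.coeff_rank_ne_zero
  have hq1 : 1 < Fintype.card F := Fintype.one_lt_card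
  -- Since α_0 = 1, the Gauss norm M is at least ρ, and this threshold yields ‖g_r‖ M > G. At index
  -- k + r the term g_r α_k^(q^r) then strictly exceeds every term with j < r, each of which is at
  -- most G M^(q^r - 1) after scaling.
  refine ⟨1 + G / ‖g r‖, by simp; positivity, fun ρ hρ k hk => ?_⟩
  have hρ1 : 1 ≤ ρ := le_trans (by simp; positivity) hρ
  have hρ0 : 0 < ρ := by linarith
  set M := ‖φ.expCoeff k‖ * ρ ^ Fintype.card F ^ k with hM
  have hMρ : ρ ≤ M := by
    have := hk 0
    rwa [show φ.expCoeff 0 = 1 by rw [expCoeff], norm_one, one_mul, pow_zero, pow_one] at this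
  have hM1 : 1 ≤ M := hρ1.trans hMρ
  have hGM : G < ‖g r‖ * M := by
    have : G / ‖g r‖ < M := by linarith
    rwa [div_lt_iff₀' hgr] at this
  set m := k + r
  have hL : ‖φ.expCoeff m‖ * (Fintype.card F * ρ) ^ Fintype.card F ^ m
      = ‖(twAct (shiftHom F) (φ.toAlgHom Polynomial.X) φ.expSeq).1 m‖ * ρ ^ Fintype.card F ^ m := by
    rw [twAct_expSeq, norm_mul, norm_pow, norm_θ, mul_pow]
    ring
  have hpos : 0 < ρ ^ Fintype.card F ^ m := by positivity
  rw [hL, twAct_shift_apply, ← Finset.add_sum_erase _ _ (Finset.mem_range.2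
    (show r < m + 1 by omega))]
  set lead := g r * φ.expCoeff (m - r) ^ Fintype.card F ^ r with hlead
  have hleadn : ‖lead‖ * ρ ^ Fintype.card F ^ m = ‖g r‖ * M ^ Fintype.card F ^ r := by
    rw [hlead, hM, norm_mul, norm_pow, show m - r = k by omega, mul_pow, ← pow_mul ρ, ← pow_add,
      mul_assoc]
  have hrest : ∀ j, j ∈ (Finset.range (m + 1)).erase r →
      ‖g j * φ.expCoeff (m - j) ^ Fintype.card F ^ j‖ * ρ ^ Fintype.card F ^ m
        ≤ G * M ^ (Fintype.card F ^ r - 1) := by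
    intro j hj
    have hjm : j ≤ m := Nat.lt_succ_iff.1 (Finset.mem_range.1 (Finset.mem_of_mem_erase hj))
    rcases lt_or_gt_of_ne (Finset.ne_of_mem_erase hj) with hjr | hjr
    · rw [norm_mul, norm_pow]
      calc _ = ‖g j‖ * (‖φ.expCoeff (m - j)‖ * ρ ^ Fintype.card F ^ (m - j)) ^
                Fintype.card F ^ j := by
            rw [mul_pow, ← pow_mul ρ, ← pow_add, Nat.sub_add_cancel hjm, ← mul_assoc]
        _ ≤ G * M ^ Fintype.card F ^ j := by
            gcongr
            · exact hG j
            · exact hk _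
        _ ≤ _ := by
            gcongr
            exact Nat.le_sub_one_of_lt (Nat.pow_lt_pow_right hq1 hjr)
    · rw [show g j = 0 from φ.coeff_eq_zero_of_lt j hjr, zero_mul, norm_zero, zero_mul]
      positivity
  have hsum : ‖∑ j ∈ (Finset.range (m + 1)).erase r,
      g j * φ.expSeq.1 (m - j) ^ Fintype.card F ^ j‖
      ≤ G * M ^ (Fintype.card F ^ r - 1) / ρ ^ Fintype.card F ^ m :=
    IsUltrametricDist.norm_sum_le_of_forall_le_of_nonneg (by positivity) fun j hj => by
      rw [le_div_iff₀ hpos]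
      exact hrest j hj
  have hlt : ‖∑ j ∈ (Finset.range (m + 1)).erase r,
      g j * φ.expSeq.1 (m - j) ^ Fintype.card F ^ j‖ < ‖lead‖ := by
    refine hsum.trans_lt ?_
    rw [div_lt_iff₀ hpos, hleadn]
    have : M ^ Fintype.card F ^ r = M * M ^ (Fintype.card F ^ r - 1) := by
      rw [← pow_succ', Nat.sub_add_cancel (Nat.one_le_pow _ _ Fintype.card_pos)]
    rw [this, ← mul_assoc]
    exact mul_lt_mul_of_pos_right hGM (by positivity)
  have := IsUltrametricDist.norm_add_eq_max_of_norm_ne_norm hlt.ne'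
  rw [max_eq_left hlt.le] at this
  rw [← hleadn]
  refine le_of_eq (congrArg (· * _) ?_)
  exact this.symm

/-- If `δ_θ` has degree at most `r`, then `F_δ` grows at most as fast as `e_φ`. -/
lemma exists_norm_quasiCoeff_le (δ : φ.Biderivation)
    (hδ : ∀ j, r < j → SkewPolynomial.coeff (δ.1 Polynomial.X) j = 0) :
    ∃ C ρ₀ : ℝ, 0 ≤ C ∧ 1 ≤ ρ₀ ∧ ∀ ρ, ρ₀ ≤ ρ → ∃ m, ∀ n,
      ‖φ.quasiCoeff δ n‖ * (Fintype.card F * ρ) ^ Fintype.card F ^ n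
        ≤ C * (‖φ.expCoeff m‖ * (Fintype.card F * ρ) ^ Fintype.card F ^ m) := by
  obtain ⟨D, hD0, hD⟩ := exists_norm_coeff_le (δ.1 Polynomial.X)
  obtain ⟨ρ₀, hρ₀, h⟩ := φ.exists_norm_expCoeff_ge
  set gr := SkewPolynomial.coeff (φ.toAlgHom Polynomial.X) r with hgr'
  have hgr : 0 < ‖gr‖ := norm_pos_iff.2 φ.coeff_rank_ne_zero
  have hq : (0 : ℝ) < Fintype.card F := by exact_mod_cast Fintype.card_pos
  refine ⟨D / ‖gr‖, ρ₀, by positivity, hρ₀, fun ρ hρ => ?_⟩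
  have hρ1 : 1 ≤ ρ := hρ₀.trans hρ
  have hρ0 : 0 < ρ := by linarith
  have h00 : φ.expCoeff 0 = 1 := by rw [expCoeff]
  obtain ⟨k, hk⟩ := exists_forall_norm_coeff_le φ.expSeq hρ0
    (by change φ.expCoeff 0 ≠ 0; rw [h00]; exact one_ne_zero)
  have hM : 1 ≤ ‖φ.expCoeff k‖ * ρ ^ Fintype.card F ^ k := by
    have := hk 0
    change ‖φ.expCoeff 0‖ * _ ≤ _ at this
    rw [h00, norm_one, one_mul, pow_zero, pow_one] at this
    exact hρ1.trans this
  -- Both sides are compared with M^(q^r), where M is the Gauss norm of e_φ at radius ρ: F_δ from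
  -- above, e_φ from below through its coefficient of index k + r.
  refine ⟨k + r, fun n => ?_⟩
  calc _ ≤ D * (‖φ.expCoeff k‖ * ρ ^ Fintype.card F ^ k) ^ Fintype.card F ^ r := by
        cases n with
        | zero =>
          rw [show φ.quasiCoeff δ 0 = 0 by rw [quasiCoeff], norm_zero, zero_mul]
          positivity
        | succ n =>
          -- The denominator θ^(q^n) - θ has norm q^(q^n), which is exactly what turns radius qρ
          -- into radius ρ.
          refine le_trans (le_of_eq ?_)
            (φ.norm_twAct_expSeq_le _ hδ hρ0 hM hD hk (n + 1))
          rw [quasiCoeff_succ, norm_mul, norm_inv, norm_θ_pow_sub, mul_pow]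
          field_simp
    _ = D / ‖gr‖ * (‖gr‖ *
          (‖φ.expCoeff k‖ * ρ ^ Fintype.card F ^ k) ^ Fintype.card F ^ r) := by
        field_simp
    _ ≤ _ := by
        exact mul_le_mul_of_nonneg_left (h ρ hρ k hk) (by positivity)

/-- A quasi-periodic function `F_δ` with `δ_θ` of degree at most `r` which vanishes on the period
lattice is zero. -/
theorem quasiCoeff_eq_zero (δ : φ.Biderivation)
    (hδ : ∀ j, r < j → SkewPolynomial.coeff (δ.1 Polynomial.X) j = 0)
    (hΛ : ∀ z ∈ φ.periodLattice, φ.quasiPeriodicFun δ z = 0) (n : ℕ) :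
    φ.quasiCoeff δ n = 0 := by
  classical
  by_contra hn
  have hex : ∃ n, φ.quasiCoeff δ n ≠ 0 := ⟨n, hn⟩
  set k := Nat.find hex with hkdef
  have hk : φ.quasiCoeff δ k ≠ 0 := Nat.find_spec hex
  have hk' : ∀ n < k, φ.quasiCoeff δ n = 0 := fun n hn => not_not.1 (Nat.find_min hex hn)
  -- F_δ has no linear term, so its first nonzero term has exponent q^k ≥ 2. This gap with the
  -- linear bound Cρ gives the contradiction.
  have hk0 : k ≠ 0 := by
    intro h0
    rw [h0] at hk
    exact hk (by rw [quasiCoeff])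
  obtain ⟨C, ρ₀, hC0, hρ₀, hC⟩ := φ.exists_norm_quasiCoeff_le δ hδ
  obtain ⟨ε, hε, hcoeff, hiso⟩ := φ.exists_isometry_radius
  have hq2 : 2 ≤ Fintype.card F := Fintype.one_lt_card
  have hq : (1 : ℝ) < Fintype.card F := by exact_mod_cast Fintype.one_lt_card
  have hck : 0 < ‖φ.quasiCoeff δ k‖ := norm_pos_iff.2 hk
  obtain ⟨N, hN⟩ : ∃ N : ℕ, max ρ₀ (C / ‖φ.quasiCoeff δ k‖) ≤ (Fintype.card F : ℝ) ^ N * ε := by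
    obtain ⟨N, hN⟩ := pow_unbounded_of_one_lt (max ρ₀ (C / ‖φ.quasiCoeff δ k‖) / ε) hq
    exact ⟨N, (div_le_iff₀ hε).1 hN.le⟩
  obtain ⟨m, hm⟩ := hC _ ((le_max_left _ _).trans hN)
  set ρ := (Fintype.card F : ℝ) * ((Fintype.card F : ℝ) ^ N * ε) with hρ
  have hρN : (Fintype.card F : ℝ) ^ N * ε < ρ := by
    rw [hρ]
    exact lt_mul_of_one_lt_left (by positivity) hq
  have hρ1 : 1 ≤ ρ := (hρ₀.trans ((le_max_left _ _).trans hN)).trans hρN.le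
  have hρ0 : 0 < ρ := by linarith
  -- The radius ρ = q^(N+1) ε has both required forms: q times a large radius for the growth
  -- estimate, and a power of q times ε for the supply of periods.
  obtain ⟨W, hW, hWexp⟩ := φ.exists_periods_norm_expCoeff_le hε hcoeff hiso (N + 1) (ρ := ρ)
    (by rw [hρ, pow_succ]; ring)
  have hJ := norm_coeff_le_prod_of_seriesEval_eq_zero (φ.quasiSeq δ) k hk' hρ0 hm W
    fun w hw => ⟨(hW w hw).2.1, (hW w hw).2.2, hΛ w (hW w hw).1⟩
  have hprod : (∏ w ∈ W, (ρ / ‖w‖)) * ∏ w ∈ W, (‖w‖ / ρ) = 1 := by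
    rw [← Finset.prod_mul_distrib]
    refine Finset.prod_eq_one fun w hw => ?_
    have := norm_pos_iff.2 (hW w hw).2.1
    field_simp
  have h1 : ‖φ.quasiCoeff δ k‖ * ρ ^ 2 ≤ C * ρ := by
    calc _ ≤ ‖φ.quasiCoeff δ k‖ * ρ ^ Fintype.card F ^ k := by
          gcongr
          exact hq2.trans (Nat.le_self_pow hk0 _)
      _ ≤ _ := hJ
      _ ≤ C * (ρ * ∏ w ∈ W, (ρ / ‖w‖)) * ∏ w ∈ W, (‖w‖ / ρ) := by
          refine mul_le_mul_of_nonneg_right (mul_le_mul_of_nonneg_left (hWexp m) hC0) ?_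
          positivity
      _ = C * ρ * ((∏ w ∈ W, (ρ / ‖w‖)) * ∏ w ∈ W, (‖w‖ / ρ)) := by ring
      _ = C * ρ := by rw [hprod, mul_one]
  have h2 : C / ‖φ.quasiCoeff δ k‖ < ρ := ((le_max_right _ _).trans hN).trans_lt hρN
  rw [div_lt_iff₀ hck] at h2
  nlinarith

/-- A biderivation is determined by its value at `θ`. -/
lemma biderivation_ext {δ ε : φ.Biderivation} (h : δ.1 Polynomial.X = ε.1 Polynomial.X) :
    δ = ε := by
  refine Subtype.ext (LinearMap.ext fun a => ?_)
  have hone : ∀ η : φ.Biderivation, η.1 1 = 0 := fun η => by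
    have h := η.2.2 1 1
    rw [mul_one, map_one φ.toAlgHom, map_one (algebraMap F[X] (CInfty F)), one_smul, mul_one] at h
    exact left_eq_add.1 h
  induction a using Polynomial.induction_on with
  | C c =>
    rw [← mul_one (Polynomial.C c), ← Polynomial.smul_eq_C_mul, map_smul, map_smul, hone, hone]
  | add p q hp hq => rw [map_add, map_add, hp, hq]
  | monomial n c ih => rw [pow_succ, ← mul_assoc, δ.2.2, ε.2.2, ih, h]

/-- If F_δ = 0 then δ_θ ∘ e_φ = 0. Because α_0 = 1, its n-th coefficient is the n-th coefficient of
δ_θ plus terms involving earlier ones, so all of them vanish in turn. -/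
lemma eq_zero_of_quasiCoeff_eq_zero (δ : φ.Biderivation) (h : ∀ n, φ.quasiCoeff δ n = 0) :
    δ = 0 := by
  refine φ.biderivation_ext ?_
  change δ.1 Polynomial.X = 0
  ext n
  rw [SkewPolynomial.coeff_zero]
  induction n using Nat.strong_induction_on with
  | _ n ih =>
    have h1 := φ.quasiCoeff_rel δ n
    rw [h, mul_zero, mul_zero, zero_add, twAct_shift_apply, Finset.sum_range_succ,
      Finset.sum_eq_zero fun j hj => by rw [ih j (Finset.mem_range.1 hj), zero_mul], zero_add,
      Nat.sub_self, show φ.expSeq.1 0 = 1 from by change φ.expCoeff 0 = 1; rw [expCoeff],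
      one_pow, mul_one] at h1
    exact h1.symm

end DrinfeldModule
end DrinfeldDeRham

/-! ### Reduced representatives and construction of biderivations. -/

namespace DrinfeldDeRham
open scoped Polynomial
open Filter Topology

variable {F : Type*} [Field F] [Fintype F]

lemma coeff_monomial_mul (n : ℕ) (b : CInfty F) (f : TwistedPolynomial F) (k : ℕ) :
    SkewPolynomial.coeff (SkewPolynomial.monomial n b * f) k
      = if n ≤ k then b * SkewPolynomial.coeff f (k - n) ^ Fintype.card F ^ n else 0 := by
  induction f using SkewPolynomial.induction with
  | h0 => simp
  | ha m s p _ _ ih =>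
    rw [mul_add, SkewPolynomial.coeff_add, ih, SkewPolynomial.coeff_add,
      SkewPolynomial.monomial_mul_monomial, SkewPolynomial.φ_iterate_apply, twist_smul,
      SkewPolynomial.coeff_monomial, SkewPolynomial.coeff_monomial, ← frob_iterate, ← frob_iterate,
      ← frob_iterate, iterate_map_add]
    by_cases h : n ≤ k
    · rw [if_pos h, if_pos h, mul_add]
      congr 1
      by_cases h2 : m = k - n
      · rw [if_pos (by omega), if_pos h2]
      · rw [if_neg (by omega), if_neg h2, iterate_map_zero, mul_zero]
    · rw [if_neg (by omega), if_neg h, if_neg h, add_zero]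

lemma monomial_zero_mul (c : CInfty F) (f : TwistedPolynomial F) :
    SkewPolynomial.monomial 0 c * f = c • f := by
  ext k
  rw [coeff_monomial_mul, if_pos (Nat.zero_le k), pow_zero, pow_one, Nat.sub_zero]
  rfl

lemma coeff_smul (c : CInfty F) (f : TwistedPolynomial F) (k : ℕ) :
    SkewPolynomial.coeff (c • f) k = c * SkewPolynomial.coeff f k := rfl

/-- Together with finite generation over the principal ideal domain F[X], this makes Λ free, so that
it has a finite basis. -/
instance : Module.IsTorsionFree F[X] (CInfty F) := by
  have : Function.Injective (algebraMap F[X] (CInfty F)) :=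
    (algebraMap (KInfty F) (CInfty F)).injective.comp
      ((algebraMap (RatFunc F) (KInfty F)).injective.comp (RatFunc.algebraMap_injective F))
  have := (faithfulSMul_iff_algebraMap_injective F[X] (CInfty F)).2 this
  infer_instance

namespace DrinfeldModule

variable {r : ℕ} (φ : DrinfeldModule F r)

/-- Modulo strictly inner biderivations, `δ_θ` may be taken of degree at most `r`. -/
lemma exists_sub_strictlyInnerOf (hr : r ≠ 0) (δ : φ.Biderivation) :
    ∃ m : augmentation F, ∀ j, r < j →
      SkewPolynomial.coeff ((δ - φ.strictlyInnerOf m).1 Polynomial.X) j = 0 := by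
  suffices H : ∀ N (δ : φ.Biderivation),
      (∀ j, r + N < j → SkewPolynomial.coeff (δ.1 Polynomial.X) j = 0) →
      ∃ m : augmentation F, ∀ j, r < j →
        SkewPolynomial.coeff ((δ - φ.strictlyInnerOf m).1 Polynomial.X) j = 0 by
    refine H ((δ.1 Polynomial.X).support.sup id) δ fun j hj => ?_
    rw [← SkewPolynomial.notMem_support_iff]
    intro h
    have := Finset.le_sup (f := id) h
    simp only [id] at this
    omega
  intro N
  induction N with
  | zero => exact fun δ h => ⟨0, by simpa using h⟩
  | succ N ih =>
    intro δ h
    set g := SkewPolynomial.coeff (φ.toAlgHom Polynomial.X) r with hg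
    have hg0 : g ^ Fintype.card F ^ (N + 1) ≠ 0 := pow_ne_zero _ φ.coeff_rank_ne_zero
    set c := SkewPolynomial.coeff (δ.1 Polynomial.X) (r + (N + 1)) with hc
    -- In δ_θ - θm + m φ_θ the degree r + N + 1 coefficient is c plus the coefficient of m times
    -- g^(q^(N+1)); the choice cancels it. The term θm has degree N + 1, which is lower since r ≠ 0,
    -- and N + 1 ≥ 1 keeps m without constant term.
    let m : augmentation F := ⟨SkewPolynomial.monomial (N + 1) (-c / g ^ Fintype.card F ^ (N + 1)),
      SkewPolynomial.coeff_monomial_succ⟩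
    have hm : (φ.strictlyInnerOf m).1 Polynomial.X
        = θ F • m.1 - m.1 * φ.toAlgHom Polynomial.X := rfl
    obtain ⟨m', hm'⟩ := ih (δ - φ.strictlyInnerOf m) fun j hj => by
      change SkewPolynomial.coeff (δ.1 Polynomial.X - (φ.strictlyInnerOf m).1 Polynomial.X) j = 0
      rw [hm, SkewPolynomial.coeff_sub, SkewPolynomial.coeff_sub, coeff_smul,
        coeff_monomial_mul, SkewPolynomial.coeff_monomial, if_neg (by omega), if_pos (by omega),
        mul_zero, zero_sub, sub_neg_eq_add]
      rcases (show j = r + (N + 1) ∨ r + (N + 1) < j by omega) with rfl | hj'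
      · rw [Nat.add_sub_cancel, ← hc, ← hg, div_mul_cancel₀ _ hg0, add_neg_cancel]
      · rw [h j hj', φ.coeff_eq_zero_of_lt _ (by omega),
          zero_pow (pow_pos Fintype.card_pos _).ne', mul_zero, add_zero]
    refine ⟨m + m', fun j hj => ?_⟩
    rw [map_add, ← sub_sub]
    exact hm' j hj

/-- Every element of `C_∞{τ} τ` is the value at `θ` of a biderivation. -/
lemma exists_biderivation_X_eq (d : augmentation F) :
    ∃ δ : φ.Biderivation, δ.1 Polynomial.X = d.1 := by
  -- The biderivation rule says that a ↦ (a, δ_a; 0, φ_a) is multiplicative on upper triangular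
  -- matrices. As F[X] is free on X, the image of X may be prescribed, and δ is the upper right
  -- entry.
  let M : Matrix (Fin 2) (Fin 2) (TwistedPolynomial F) :=
    !![SkewPolynomial.monomial 0 (θ F), d.1; 0, φ.toAlgHom Polynomial.X]
  let ψ : F[X] →ₐ[F] Matrix (Fin 2) (Fin 2) (TwistedPolynomial F) := Polynomial.aeval M
  have hX : ψ Polynomial.X = M := Polynomial.aeval_X M
  have hC : ∀ c : F, ψ (Polynomial.C c) = Matrix.diagonal fun _ => algebraMap F _ c :=
    fun c => Polynomial.aeval_C M c
  have hψ : ∀ a, ψ a 0 0 = SkewPolynomial.monomial 0 (algebraMap F[X] (CInfty F) a) ∧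
      ψ a 1 0 = 0 ∧ ψ a 1 1 = φ.toAlgHom a ∧ SkewPolynomial.coeff (ψ a 0 1) 0 = 0 := by
    intro a
    induction a using Polynomial.induction_on with
    | C c =>
      rw [hC]
      refine ⟨?_, ?_, ?_, ?_⟩
      · rw [Matrix.diagonal_apply_eq]
        rfl
      · exact Matrix.diagonal_apply_ne _ (by decide)
      · rw [Matrix.diagonal_apply_eq, ← Polynomial.algebraMap_eq, AlgHom.commutes]
      · rw [Matrix.diagonal_apply_ne _ (by decide), SkewPolynomial.coeff_zero]
    | add p q hp hq =>
      simp only [map_add, Matrix.add_apply, SkewPolynomial.coeff_add, hp, hq, add_zero,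
        and_self]
    | monomial n c ih =>
      obtain ⟨h1, h2, h3, h4⟩ := ih
      rw [pow_succ, ← mul_assoc, map_mul ψ, hX, map_mul φ.toAlgHom, map_mul (algebraMap _ _)]
      refine ⟨?_, ?_, ?_, ?_⟩
      · rw [Matrix.mul_apply, Fin.sum_univ_two, h1]
        simp only [M, Matrix.of_apply, Matrix.cons_val', Matrix.cons_val_zero, Matrix.cons_val_one,
          mul_zero, add_zero]
        rw [monomial_zero_mul, SkewPolynomial.smul_monomial]
        rfl
      · rw [Matrix.mul_apply, Fin.sum_univ_two, h2]
        simp [M]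
      · rw [Matrix.mul_apply, Fin.sum_univ_two, h2, h3]
        simp [M]
      · rw [Matrix.mul_apply, Fin.sum_univ_two, SkewPolynomial.coeff_add, coeff_mul_zero,
          coeff_mul_zero, h4, zero_mul, add_zero]
        have : SkewPolynomial.coeff (M 0 1) 0 = 0 := d.2
        rw [this, mul_zero]
  refine ⟨⟨{ toFun := fun a => ψ a 0 1, map_add' := fun a b => ?_, map_smul' := fun c a => ?_ },
    fun a => (hψ a).2.2.2, fun a b => ?_⟩, ?_⟩
  · rw [map_add, Matrix.add_apply]
  · rw [map_smul, Matrix.smul_apply]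
    rfl
  · change ψ (a * b) 0 1 = _ • ψ b 0 1 + ψ a 0 1 * _
    rw [map_mul, Matrix.mul_apply, Fin.sum_univ_two, (hψ a).1, (hψ b).2.2.1, monomial_zero_mul]
  · change ψ Polynomial.X 0 1 = d.1
    rw [hX]
    rfl

/-! ### The rank of the period lattice -/

lemma finite_twEval_eq_zero {f : TwistedPolynomial F} (hf : SkewPolynomial.coeff f 0 ≠ 0) :
    {x : CInfty F | twEval f x = 0}.Finite := by
  classical
  refine (twPoly f).roots.toFinset.finite_toSet.subset fun x hx => ?_
  rw [Finset.mem_coe, Multiset.mem_toFinset, Polynomial.mem_roots (twPoly_ne_zero hf),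
    Polynomial.IsRoot, eval_twPoly]
  exact hx

lemma exp_sub (z w : CInfty F) : φ.exp (z - w) = φ.exp z - φ.exp w := by
  rw [eq_sub_iff_add_eq, ← exp_add, sub_add_cancel]

lemma twEval_X_pow_exp_div (n : ℕ) {z : CInfty F} (hz : z ∈ φ.periodLattice) :
    twEval (φ.toAlgHom (Polynomial.X ^ n)) (φ.exp (z / θ F ^ n)) = 0 := by
  rw [← exp_θ_pow_mul, mul_div_cancel₀ _ (pow_ne_zero n θ_ne_zero)]
  exact hz

lemma coeff_X_pow_zero_ne_zero (n : ℕ) :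
    SkewPolynomial.coeff (φ.toAlgHom (Polynomial.X ^ n)) 0 ≠ 0 := by
  rw [coeff_X_pow_zero]
  exact pow_ne_zero n θ_ne_zero

/-- The period lattice is discrete. -/
lemma finite_periods_norm_le (R : ℝ) : {z | z ∈ φ.periodLattice ∧ ‖z‖ ≤ R}.Finite := by
  obtain ⟨ε, hε, -, hiso⟩ := φ.exists_isometry_radius
  have hq : (1 : ℝ) < Fintype.card F := by exact_mod_cast Fintype.one_lt_card
  obtain ⟨n, hn⟩ : ∃ n : ℕ, R ≤ (Fintype.card F : ℝ) ^ n * ε := by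
    obtain ⟨N, hN⟩ := pow_unbounded_of_one_lt (R / ε) hq
    exact ⟨N, (div_le_iff₀ hε).1 hN.le⟩
  -- Division by θ^n moves these periods into the disc where e_φ preserves norms and is therefore
  -- injective; their images are roots of φ_{θ^n}.
  refine Set.Finite.of_injOn (f := fun z => φ.exp (z / θ F ^ n))
    (fun z hz => φ.twEval_X_pow_exp_div n hz.1) ?_
    (finite_twEval_eq_zero (φ.coeff_X_pow_zero_ne_zero n))
  intro z hz w hw hzw
  have h1 : ∀ y : CInfty F, ‖y‖ ≤ R → ‖y / θ F ^ n‖ ≤ ε := fun y hy => by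
    rw [norm_div, norm_pow, norm_θ, div_le_iff₀ (by positivity)]
    linarith
  have h2 : ‖z / θ F ^ n - w / θ F ^ n‖ ≤ ε :=
    (IsUltrametricDist.norm_sub_le_max' _ _).trans (max_le (h1 z hz.2) (h1 w hw.2))
  have h3 := norm_exp_of_le hiso h2
  rw [exp_sub, sub_eq_zero.2 hzw, norm_zero, eq_comm, norm_eq_zero, sub_eq_zero] at h3
  exact (div_left_inj' (pow_ne_zero n θ_ne_zero)).1 h3

/-- Descent: the values e_φ(z/θ), z in Λ, lie in the finite θ-torsion, so the classes of Λ/θΛ have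
representatives w of norm at most some M. Writing z = w + θz' gives ‖z'‖ ≤ max(‖z‖, M)/q, and
repetition ends in the ball of radius M, which contains finitely many periods. These generate Λ. -/
instance : Module.Finite F[X] φ.periodLattice := by
  rw [Module.Finite.iff_fg]
  have hq : (1 : ℝ) < Fintype.card F := by exact_mod_cast Fintype.one_lt_card
  obtain ⟨M, hM0, hM⟩ : ∃ M : ℝ, 0 < M ∧ ∀ z ∈ φ.periodLattice, ∃ w ∈ φ.periodLattice,
      ‖w‖ ≤ M ∧ φ.exp (z / θ F ^ 1) = φ.exp (w / θ F ^ 1) := by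
    have hfin : ((fun z => φ.exp (z / θ F ^ 1)) '' (φ.periodLattice : Set (CInfty F))).Finite := by
      refine (finite_twEval_eq_zero (φ.coeff_X_pow_zero_ne_zero 1)).subset ?_
      rintro _ ⟨z, hz, rfl⟩
      exact φ.twEval_X_pow_exp_div 1 hz
    obtain ⟨t, ht, hbij⟩ := Set.SurjOn.exists_bijOn_subset
      (Set.surjOn_image (fun z => φ.exp (z / θ F ^ 1)) (φ.periodLattice : Set (CInfty F)))
    have htfin : t.Finite := hbij.finite_iff_finite.2 hfin
    obtain ⟨M, hM⟩ := (htfin.image norm).bddAbove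
    refine ⟨max M 1, by positivity, fun z hz => ?_⟩
    obtain ⟨w, hw, hwz⟩ := hbij.surjOn ⟨z, hz, rfl⟩
    exact ⟨w, ht hw, (hM ⟨w, hw, rfl⟩).trans (le_max_left _ _), hwz.symm⟩
  refine ⟨(φ.finite_periods_norm_le M).toFinset, le_antisymm ?_ ?_⟩
  · rw [Submodule.span_le]
    intro z hz
    simp only [Set.Finite.coe_toFinset] at hz
    exact hz.1
  · suffices H : ∀ n : ℕ, ∀ z ∈ φ.periodLattice, ‖z‖ ≤ M * (Fintype.card F : ℝ) ^ n →
        z ∈ Submodule.span F[X]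
          (((φ.finite_periods_norm_le M).toFinset : Finset (CInfty F)) : Set (CInfty F)) by
      intro z hz
      obtain ⟨n, hn⟩ := pow_unbounded_of_one_lt (‖z‖ / M) hq
      exact H n z hz ((div_le_iff₀' hM0).1 hn.le)
    intro n
    induction n with
    | zero =>
      intro z hz hzM
      refine Submodule.subset_span ?_
      simpa using And.intro hz hzM
    | succ n ih =>
      intro z hz hzM
      obtain ⟨w, hw, hwM, hzw⟩ := hM z hz
      have hdiff : (z - w) / θ F ∈ φ.periodLattice := by
        rw [mem_periodLattice, sub_div, exp_sub]
        simpa [sub_eq_zero] using hzw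
      have hz' : z = w + (Polynomial.X : F[X]) • ((z - w) / θ F) := by
        rw [Algebra.smul_def]
        change z = w + θ F * _
        rw [mul_div_cancel₀ _ θ_ne_zero, add_sub_cancel]
      rw [hz']
      refine Submodule.add_mem _ (Submodule.subset_span (by simpa using And.intro hw hwM))
        (Submodule.smul_mem _ _ (ih _ hdiff ?_))
      rw [norm_div, norm_θ, div_le_iff₀ (by positivity), mul_assoc, ← pow_succ]
      refine (IsUltrametricDist.norm_sub_le_max' _ _).trans (max_le hzM (hwM.trans ?_))
      exact le_mul_of_one_le_right hM0.le (one_le_pow₀ hq.le)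

/-- Combinations of a basis with coefficients in F_q are distinct modulo θΛ, and λ ↦ e_φ(λ/θ)
separates classes modulo θΛ. Its values are roots of φ_θ, a polynomial of degree at most q^r, so q^n
≤ q^r for n the rank. -/
lemma finrank_periodLattice_le : Module.finrank F[X] φ.periodLattice ≤ r := by
  classical
  let b := Module.finBasis F[X] φ.periodLattice
  set n := Module.finrank F[X] φ.periodLattice
  have hf := φ.coeff_X_pow_zero_ne_zero 1
  let p := twPoly (φ.toAlgHom (Polynomial.X ^ 1))
  let L : (Fin n → F) → φ.periodLattice := fun c => ∑ i, (Polynomial.C (c i) : F[X]) • b i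
  have hinj : Function.Injective fun c => φ.exp ((L c : CInfty F) / θ F ^ 1) := by
    intro c c' hcc
    have h1 : ((L c - L c' : φ.periodLattice) : CInfty F) / θ F ∈ φ.periodLattice := by
      rw [mem_periodLattice, Submodule.coe_sub, sub_div, exp_sub, sub_eq_zero]
      simpa using hcc
    set μ : φ.periodLattice := ⟨_, h1⟩ with hμ
    have h2 : L c - L c' = (Polynomial.X : F[X]) • μ := by
      refine Subtype.ext ?_
      rw [Submodule.coe_smul, Algebra.smul_def]
      change _ = θ F * _
      rw [hμ, mul_div_cancel₀ _ θ_ne_zero]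
    funext i
    have h3 := congrArg (fun z => b.repr z i) h2
    have h4 : ∀ c : Fin n → F, b.repr (L c) i = Polynomial.C (c i) := fun c => by
      simp only [L]
      rw [b.repr_sum_self]
    simp only [map_sub, map_smul, Finsupp.sub_apply, Finsupp.smul_apply, h4] at h3
    have h5 := congrArg (fun f => Polynomial.coeff f 0) h3
    simpa [sub_eq_zero] using h5
  have hmaps : ∀ c, φ.exp ((L c : CInfty F) / θ F ^ 1) ∈ p.roots.toFinset := by
    intro c
    rw [Multiset.mem_toFinset, Polynomial.mem_roots (twPoly_ne_zero hf), Polynomial.IsRoot,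
      eval_twPoly]
    exact φ.twEval_X_pow_exp_div 1 (L c).2
  have hcard : Fintype.card F ^ n ≤ Fintype.card F ^ r := by
    calc Fintype.card F ^ n = (Finset.univ : Finset (Fin n → F)).card := by simp
      _ ≤ p.roots.toFinset.card :=
          Finset.card_le_card_of_injOn _ (fun c _ => hmaps c) hinj.injOn
      _ ≤ Multiset.card p.roots := Multiset.toFinset_card_le _
      _ ≤ p.natDegree := p.card_roots'
      _ ≤ Fintype.card F ^ r := natDegree_twPoly_le fun j hj => by
          rw [pow_one]
          exact φ.coeff_eq_zero_of_lt j hj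
  exact (Nat.pow_le_pow_iff_right Fintype.one_lt_card).1 hcard

/-! ### Biderivations of degree at most the rank -/

/-- The biderivations `δ` with `δ_θ` of degree at most the rank. -/
def reducedBiderivations : Submodule (CInfty F) φ.Biderivation where
  carrier := {δ | ∀ j, r < j → SkewPolynomial.coeff (δ.1 Polynomial.X) j = 0}
  zero_mem' _ _ := rfl
  add_mem' {δ ε} hδ hε j hj := by
    change SkewPolynomial.coeff (δ.1 Polynomial.X + ε.1 Polynomial.X) j = 0
    rw [SkewPolynomial.coeff_add, hδ j hj, hε j hj, add_zero]
  smul_mem' c δ hδ j hj := by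
    change SkewPolynomial.coeff (c • δ.1 Polynomial.X) j = 0
    rw [coeff_smul, hδ j hj, mul_zero]

/-- The coefficients of `τ, …, τ ^ r` in `δ_θ`. -/
noncomputable def reducedCoeff : φ.reducedBiderivations →ₗ[CInfty F] (Fin r → CInfty F) where
  toFun δ i := SkewPolynomial.coeff (δ.1.1 Polynomial.X) (i + 1)
  map_add' _ _ := funext fun _ => SkewPolynomial.coeff_add _ _ _
  map_smul' _ _ := rfl

lemma reducedCoeff_surjective : Function.Surjective φ.reducedCoeff := by
  intro v
  let f : TwistedPolynomial F := ∑ i : Fin r, SkewPolynomial.monomial (i + 1 : ℕ) (v i)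
  have hf : ∀ j, SkewPolynomial.coeff f j = ∑ i : Fin r, if (i : ℕ) + 1 = j then v i else 0 := by
    intro j
    let c : TwistedPolynomial F →+ CInfty F :=
      ⟨⟨fun f => SkewPolynomial.coeff f j, rfl⟩, fun f g => SkewPolynomial.coeff_add f g j⟩
    change c f = _
    rw [map_sum]
    exact Finset.sum_congr rfl fun i _ => SkewPolynomial.coeff_monomial
  obtain ⟨δ, hδ⟩ := φ.exists_biderivation_X_eq ⟨f, by
    change SkewPolynomial.coeff f 0 = 0
    rw [hf]
    exact Finset.sum_eq_zero fun i _ => if_neg (Nat.succ_ne_zero _)⟩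
  refine ⟨⟨δ, fun j hj => ?_⟩, funext fun i => ?_⟩
  · rw [hδ]
    change SkewPolynomial.coeff f j = 0
    rw [hf]
    exact Finset.sum_eq_zero fun i _ => if_neg (by omega)
  · change SkewPolynomial.coeff (δ.1 Polynomial.X) (i + 1) = v i
    rw [hδ]
    change SkewPolynomial.coeff f _ = _
    rw [hf, Finset.sum_eq_single i]
    · rw [if_pos rfl]
    · intro k _ hk
      exact if_neg fun h => hk (Fin.ext (by omega))
    · exact fun h => absurd (Finset.mem_univ i) h

lemma periodMap_reduced_injective : Function.Injective (φ.periodMap ∘ₗ φ.reducedBiderivations.subtype) := by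
  rw [injective_iff_map_eq_zero]
  intro δ hδ
  refine Subtype.ext (φ.eq_zero_of_quasiCoeff_eq_zero δ.1
    (φ.quasiCoeff_eq_zero δ.1 δ.2 fun z hz => ?_))
  exact congrArg (fun f => f ⟨z, hz⟩) hδ

/-- An injective map from a space of dimension at least r to one of dimension at most r is
bijective. Injectivity also supplies the finite dimensionality of the source, so only the
surjectivity of `reducedCoeff` is needed for it. -/
lemma periodMap_reduced_surjective :
    Function.Surjective (φ.periodMap ∘ₗ φ.reducedBiderivations.subtype) := by
  let e := (Module.finBasis F[X] φ.periodLattice).constr (M' := CInfty F) (CInfty F)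
  have : Module.Finite (CInfty F) (φ.periodLattice →ₗ[F[X]] CInfty F) := Module.Finite.equiv e
  have hle : Module.finrank (CInfty F) (φ.periodLattice →ₗ[F[X]] CInfty F) ≤ r := by
    rw [← e.finrank_eq, Module.finrank_fin_fun]
    exact φ.finrank_periodLattice_le
  have : Module.Finite (CInfty F) φ.reducedBiderivations :=
    Module.Finite.of_injective _ φ.periodMap_reduced_injective
  have hge : r ≤ Module.finrank (CInfty F) φ.reducedBiderivations := by
    have := LinearMap.finrank_le_finrank_of_surjective φ.reducedCoeff_surjective
    rwa [Module.finrank_fin_fun] at this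
  have heq := le_antisymm (LinearMap.finrank_le_finrank_of_injective φ.periodMap_reduced_injective)
    (hle.trans hge)
  exact (LinearMap.injective_iff_surjective_of_finrank_eq_finrank heq).1 φ.periodMap_reduced_injective

end DrinfeldModule
end DrinfeldDeRham

/-- For every Drinfeld module of rank `r ≥ 2`, the de Rham morphism, a homomorphism of
`C_∞`-vector spaces, is an isomorphism. -/
theorem mainTheorem3 (F : Type*) [Field F] [Fintype F] (r : ℕ) (hr : 2 ≤ r)
    (φ : DrinfeldDeRham.DrinfeldModule F r) :
    Function.Bijective φ.deRhamMap := by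
  constructor
  · rw [injective_iff_map_eq_zero]
    intro x hx
    obtain ⟨δ, rfl⟩ := Submodule.Quotient.mk_surjective _ x
    obtain ⟨m, hm⟩ := φ.exists_sub_strictlyInnerOf (by omega) δ
    have h1 : φ.strictlyInner.mkQ (φ.strictlyInnerOf m) = 0 :=
      (Submodule.Quotient.mk_eq_zero _).2 ⟨m, rfl⟩
    have h2 : φ.strictlyInner.mkQ (δ - φ.strictlyInnerOf m) = Submodule.Quotient.mk δ := by
      rw [map_sub, h1, sub_zero]
      rfl
    -- The class is now written with its reduced representative, where the injectivity of the period
    -- map applies.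
    rw [← h2] at hx ⊢
    have h3 : (⟨_, hm⟩ : φ.reducedBiderivations) = 0 :=
      φ.periodMap_reduced_injective (hx.trans (map_zero _).symm)
    rw [show δ - φ.strictlyInnerOf m = 0 from congrArg Subtype.val h3, map_zero]
  · intro f
    obtain ⟨δ, hδ⟩ := φ.periodMap_reduced_surjective f
    exact ⟨Submodule.Quotient.mk δ.1, hδ⟩
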